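/- Let $d\ge 3$ and $2-d<b<0$, and let $W:\mathbb{R}^d\to(0,\infty]$ be the Riesz potential $W(x)=-\frac{|x|^b}{b}$ for $x\neq 0$, $W(0)=+\infty$. For $U:\mathbb{R}^d\to\mathbb{R}$ continuous and bounded from below, and a Borel probability measure $\rho$ on $\mathbb{R}^d$, put $$E_{W,U}[\rho]=\frac12\int_{\mathbb{R}^d}\int_{\mathbb{R}^d}W(x-y)\,d\rho(y)\,d\rho(x)+\int_{\mathbb{R}^d}U\,d\rho\in\mathbb{R}\cup\{\infty\},\qquad V[\rho]=W*\rho+U .$$ A minimizer of $E_{W,U}$ is a Borel probability measure on $\mathbb{R}^d$ at which $E_{W,U}$ attains its minimum over all Borel probability measures on $\mathbb{R}^d$. A mollifier is a smooth, radially decreasing (in the weak sense), nonnegative function $\phi$ on $\mathbb{R}^d$ that is supported in $\overline{B(0;1)}$ and has integral $1$. Call $\rho_\sharp$ a subthreshold density for $U$ if it is a smooth radial probability density with $\operatorname{supp}\rho_\sharp=\overline{B(0;R)}$ for some $R>0$, $W*\rho_\sharp$ is continuous on $\mathbb{R}^d$, and $$\sup_{B(0;R)}V[\rho_\sharp]<0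 .$$ Then the following hold. (i) $\Delta W<0$ on $\mathbb{R}^d\setminus\{0\}$. (ii) There exists a smooth radial $U:\mathbb{R}^d\to\mathbb{R}$ with $\lim_{|x|\to\infty}U(x)=0$ that has a subthreshold density, but for which $E_{W,U}$ does not admit a minimizer. (iii) More precisely, let $\phi$ be any mollifier and $U=-W*\phi$. Then $U$ is real-valued, smooth and radial, $\lim_{|x|\to\infty}U(x)=0$, and there exists $\alpha_0\in(0,1)$ such that for every $\alpha\in(\alpha_0,1)$ the potential $\alpha U=-\alpha W*\phi$ has a subthreshold density, but $E_{W,\alpha U}$ does not admit a minimizer. -/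

import Mathlib

open MeasureTheory Filter Topology Metric
open scoped ContDiff

noncomputable section

namespace InteractionEnergy

/-- The integral `∫ f dμ = ∫ f⁺ dμ - ∫ f⁻ dμ` of an extended-real-valued function. It is a
genuine integral whenever one of the two parts has finite integral, in particular when `f` is
measurable and bounded from below and `μ` is finite, and then takes values in `ℝ ∪ {∞}`. -/
def extIntegral {X : Type*} [MeasurableSpace X] (μ : Measure X) (f : X → EReal) : EReal :=
  ((∫⁻ x, (f x).toENNReal ∂μ : ENNReal) : EReal) -
    ((∫⁻ x, (-f x).toENNReal ∂μ : ENNReal) : EReal)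

/-- The Riesz potential `W(x) = -|x|^b / b` with `b < 0`, as a function with values in
`ℝ ∪ {∞}`; its value at the origin is the limit `+∞`. -/
def riesz {d : ℕ} (b : ℝ) (x : EuclideanSpace ℝ (Fin d)) : EReal :=
  open Classical in if x = 0 then ⊤ else ((-(‖x‖ ^ b) / b : ℝ) : EReal)

/-- The convolution `(W * ρ)(x) = ∫ W(x - y) dρ(y)`. -/
def conv {d : ℕ} (W : EuclideanSpace ℝ (Fin d) → EReal)
    (ρ : Measure (EuclideanSpace ℝ (Fin d))) (x : EuclideanSpace ℝ (Fin d)) : EReal :=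
  extIntegral ρ (fun y => W (x - y))

/-- The generated potential `V[ρ] = W * ρ + U`. -/
def genPotential {d : ℕ} (W U : EuclideanSpace ℝ (Fin d) → EReal)
    (ρ : Measure (EuclideanSpace ℝ (Fin d))) (x : EuclideanSpace ℝ (Fin d)) : EReal :=
  conv W ρ x + U x

/-- The energy `E_{W,U}[ρ] = 1/2 ∫∫ W(x - y) dρ(y) dρ(x) + ∫ U dρ`. -/
def energy {d : ℕ} (W U : EuclideanSpace ℝ (Fin d) → EReal)
    (ρ : Measure (EuclideanSpace ℝ (Fin d))) : EReal :=
  ((1 / 2 : ℝ) : EReal) * extIntegral ρ (fun x => extIntegral ρ (fun y => W (x - y)))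
    + extIntegral ρ U

/-- `ρ` minimizes `E_{W,U}` among all Borel probability measures on `ℝ^d`. -/
def IsMinimizer {d : ℕ} (W U : EuclideanSpace ℝ (Fin d) → EReal)
    (ρ : Measure (EuclideanSpace ℝ (Fin d))) : Prop :=
  IsProbabilityMeasure ρ ∧
    ∀ ν : Measure (EuclideanSpace ℝ (Fin d)), IsProbabilityMeasure ν →
      energy W U ρ ≤ energy W U ν

/-- A function on `ℝ^d` is radial if it depends only on `|x|`. -/
def IsRadial {d : ℕ} (f : EuclideanSpace ℝ (Fin d) → ℝ) : Prop :=
  ∀ x y, ‖x‖ = ‖y‖ → f x = f y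

/-- The measure with Lebesgue density `f` (for `f ≥ 0`). -/
def densityMeasure {d : ℕ} (f : EuclideanSpace ℝ (Fin d) → ℝ) :
    Measure (EuclideanSpace ℝ (Fin d)) :=
  volume.withDensity (fun x => ENNReal.ofReal (f x))

/-- A mollifier: a smooth, radially decreasing, nonnegative function supported on the closed
unit ball, with integral `1`. -/
structure IsMollifier {d : ℕ} (φ : EuclideanSpace ℝ (Fin d) → ℝ) : Prop where
  smooth : ContDiff ℝ ∞ φ
  nonneg : ∀ x, 0 ≤ φ x
  radially_decreasing : ∀ x y, ‖x‖ ≤ ‖y‖ → φ y ≤ φ x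
  supported : tsupport φ ⊆ closedBall 0 1
  integral_eq_one : ∫ x, φ x = 1

/-- `ρ` is a smooth radial probability density whose support is the closed ball of radius
`R > 0`, whose potential `W * ρ` is continuous, and whose generated potential satisfies
`sup_{B(0;R)} V[ρ] < 0`. -/
structure IsSubthreshold {d : ℕ} (W U : EuclideanSpace ℝ (Fin d) → EReal)
    (ρ : EuclideanSpace ℝ (Fin d) → ℝ) (R : ℝ) : Prop where
  radius_pos : 0 < R
  smooth : ContDiff ℝ ∞ ρ
  radial : IsRadial ρ
  nonneg : ∀ x, 0 ≤ ρ x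
  isProbabilityMeasure : IsProbabilityMeasure (densityMeasure ρ)
  support_eq : tsupport ρ = closedBall 0 R
  continuous_conv : Continuous (conv W (densityMeasure ρ))
  sup_lt : (⨆ x ∈ ball (0 : EuclideanSpace ℝ (Fin d)) R,
    genPotential W U (densityMeasure ρ) x) < 0

end InteractionEnergy

end

/-!
Write `W(x) = -|x|^b / b` for the Riesz kernel and `h = W * φ` for the potential of a mollifier, so
that the external potential is `-α h`.

*Subthreshold density.* Let `ρ` be the dilate `2^(-d) φ(x/2)`. A radial density satisfies
`y φ(y) = -∇Ψ(y)` with `Ψ ≥ 0` compactly supported (`exists_radial_primitive`), hence, integrating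
by parts,
`d/dt ∫ W(x - t y) φ(y) dy = ∫ ∇W(x - t y) · ∇Ψ(y) dy = t ∫ ΔW(x - t y) Ψ(y) dy`,
which is negative because `W` is superharmonic. Integrating over `1 ≤ t ≤ 2` gives `W * ρ < h`
pointwise (`potential_dilate_lt`). The singularity of `W` is avoided by working with
`-(|x|² + a)^(b/2) / b`, for which the bound on the derivative is uniform in `0 < a ≤ 1`, and then
letting `a → 0`. By compactness the ratio of the two potentials is at most some `q < 1` on the
support of `ρ`, so `W * ρ - α h < 0` there for every `α > q` (`exists_isSubthreshold`).

*No minimizer.* By the Gamma integral, `W(x - y)` is a positive superposition of products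
`exp(-2 s |x - z|²) exp(-2 s |y - z|²)` (`kernel_eq_lintegral_gauss`). Hence `W` is positive
definite, and if `⟨μ - ν, μ - ν⟩ = 0` then `μ` and `ν` have equal convolutions with
Gaussians, thus equal mass (`measure_univ_eq_of_interaction_le`). Now
`E[μ] = ⟨μ - α φ, μ - α φ⟩ / 2 - α² ⟨φ, φ⟩ / 2`, and the competitors `α φ + (1 - α) φ_n`, with `φ_n`
the dilate of `φ` by `n`, have energies tending to `-α² ⟨φ, φ⟩ / 2`. So a minimizer `μ` would have
`⟨μ - α φ, μ - α φ⟩ = 0` and mass `α < 1` (`not_exists_isMinimizer`).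

All interaction energies are integrals in `[0, ∞]` of the nonnegative kernel; only finite quantities
are subtracted.
-/

noncomputable section

namespace InteractionEnergy

variable {d : ℕ} {b : ℝ}

/-! ### The Riesz kernel and its potentials -/

/-- The Euclidean space `ℝ^d`. -/
abbrev Space (d : ℕ) := EuclideanSpace ℝ (Fin d)

/-- The real-valued Riesz kernel `-|x|^b / b`. For `b < 0` its value at the origin is the junk
value `0`, which does not matter for integrals against Lebesgue measure. -/
def rieszReal (b : ℝ) (x : Space d) : ℝ := -(‖x‖ ^ b) / b

/-- The Riesz kernel with values in `[0, ∞]`, equal to `∞` at the origin. -/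
def kernel (b : ℝ) (x : Space d) : ENNReal := (riesz b x).toENNReal

/-- The potential `W * φ` of a density `φ`, as a real-valued Lebesgue integral. -/
def potential (b : ℝ) (φ : Space d → ℝ) (x : Space d) : ℝ := ∫ y, rieszReal b (x - y) * φ y

lemma riesz_of_ne_zero {x : Space d} (hx : x ≠ 0) : riesz b x = (rieszReal b x : EReal) := by
  simp [riesz, rieszReal, hx]

lemma rieszReal_nonneg (hb0 : b < 0) (x : Space d) : 0 ≤ rieszReal b x := by
  rw [rieszReal, neg_div, ← div_neg]
  exact div_nonneg (Real.rpow_nonneg (norm_nonneg x) b) (by linarith)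

lemma rieszReal_pos (hb0 : b < 0) {x : Space d} (hx : x ≠ 0) : 0 < rieszReal b x := by
  rw [rieszReal, neg_div, ← div_neg]
  exact div_pos (Real.rpow_pos_of_pos (norm_pos_iff.2 hx) b) (by linarith)

lemma toReal_riesz (hb0 : b < 0) (x : Space d) : (riesz b x).toReal = rieszReal b x := by
  by_cases hx : x = 0
  · subst hx
    simp [riesz, rieszReal, Real.zero_rpow hb0.ne]
  · simp [riesz_of_ne_zero hx]

lemma riesz_nonneg (hb0 : b < 0) (x : Space d) : 0 ≤ riesz b x := by
  by_cases hx : x = 0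
  · simp [riesz, hx]
  · rw [riesz_of_ne_zero hx]
    exact_mod_cast rieszReal_nonneg hb0 x

lemma kernel_of_ne_zero {x : Space d} (hx : x ≠ 0) :
    kernel b x = ENNReal.ofReal (rieszReal b x) := by
  rw [kernel, riesz_of_ne_zero hx, EReal.toENNReal_of_ne_top (EReal.coe_ne_top _),
    EReal.toReal_coe]

lemma kernel_zero : kernel b (0 : Space d) = ⊤ := by
  simp [kernel, riesz]

lemma kernel_congr_norm {x y : Space d} (h : ‖x‖ = ‖y‖) : kernel b x = kernel b y := by
  by_cases hx : x = 0
  · have hy : y = 0 := by simpa [hx] using h.symm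
    rw [hx, hy]
  · have hy : y ≠ 0 := by
      rintro rfl
      simp_all
    simp [kernel_of_ne_zero hx, kernel_of_ne_zero hy, rieszReal, h]

lemma measurable_rieszReal : Measurable (rieszReal b : Space d → ℝ) := by
  unfold rieszReal
  fun_prop

lemma measurable_kernel : Measurable (kernel b : Space d → ENNReal) := by
  classical
  have h : (kernel b : Space d → ENNReal) =
      Set.piecewise {0} (fun _ => ⊤) (fun x => ENNReal.ofReal (rieszReal b x)) := by
    funext x
    by_cases hx : x = 0
    · simp [hx, kernel_zero]
    · simp [hx, kernel_of_ne_zero hx]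
  rw [h]
  exact Measurable.piecewise (measurableSet_singleton 0) measurable_const
    measurable_rieszReal.ennreal_ofReal

lemma extIntegral_of_nonneg {X : Type*} [MeasurableSpace X] (μ : Measure X) {f : X → EReal}
    (hf : ∀ x, 0 ≤ f x) : extIntegral μ f = ((∫⁻ x, (f x).toENNReal ∂μ : ENNReal) : EReal) := by
  have h : ∀ x, (-f x).toENNReal = 0 := fun x =>
    EReal.toENNReal_of_nonpos (by simpa using hf x)
  simp [extIntegral, h]

lemma conv_riesz (hb0 : b < 0) (ρ : Measure (Space d)) (x : Space d) :
    conv (riesz b) ρ x = ((∫⁻ y, kernel b (x - y) ∂ρ : ENNReal) : EReal) :=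
  extIntegral_of_nonneg ρ fun y => riesz_nonneg hb0 (x - y)

/-- The Riesz kernel is locally integrable since `b > -d`. -/
lemma locallyIntegrable_rieszReal (hd : 3 ≤ d) (hb : 2 - (d : ℝ) < b) :
    LocallyIntegrable (rieszReal b : Space d → ℝ) volume := by
  refine locallyIntegrable_of_norm_le_rpow (C := |b|⁻¹) (α := -b) (by simp; omega)
    (by simp; linarith) (Eventually.of_forall fun x => ?_) measurable_rieszReal.aestronglyMeasurable
  rw [rieszReal, norm_div, norm_neg, neg_neg, Real.norm_eq_abs, Real.norm_eq_abs,
    abs_of_nonneg (Real.rpow_nonneg (norm_nonneg x) b), div_eq_inv_mul]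

lemma integrable_rieszReal_mul (hd : 3 ≤ d) (hb : 2 - (d : ℝ) < b) {φ : Space d → ℝ}
    (hφ : Continuous φ) (hc : HasCompactSupport φ) (x : Space d) :
    Integrable fun y => rieszReal b (x - y) * φ y := by
  have h := hc.convolutionExists_left (ContinuousLinearMap.mul ℝ ℝ) (μ := volume) hφ
    (locallyIntegrable_rieszReal hd hb) x
  simpa [ConvolutionExistsAt, mul_comm] using h

lemma potential_eq_convolution (φ : Space d → ℝ) :
    potential b φ = convolution φ (rieszReal b) (ContinuousLinearMap.mul ℝ ℝ) volume := by
  funext x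
  simp [potential, convolution, mul_comm]

lemma contDiff_potential (hd : 3 ≤ d) (hb : 2 - (d : ℝ) < b) {φ : Space d → ℝ}
    (hφ : ContDiff ℝ ∞ φ) (hc : HasCompactSupport φ) : ContDiff ℝ ∞ (potential b φ) := by
  rw [potential_eq_convolution]
  exact hc.contDiff_convolution_left _ hφ (locallyIntegrable_rieszReal hd hb)

lemma ae_sub_ne_zero (hd : 3 ≤ d) (x : Space d) : ∀ᵐ y : Space d, x - y ≠ 0 := by
  have : Nontrivial (Space d) := by
    have : Nonempty (Fin d) := ⟨⟨0, by omega⟩⟩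
    infer_instance
  filter_upwards [compl_mem_ae_iff.2 (measure_singleton (μ := volume) x)] with y hy h
  exact hy (sub_eq_zero.1 h).symm

lemma lintegral_kernel_densityMeasure (hd : 3 ≤ d) (hb : 2 - (d : ℝ) < b) (hb0 : b < 0)
    {φ : Space d → ℝ} (hφ : Continuous φ) (hc : HasCompactSupport φ) (h0 : ∀ x, 0 ≤ φ x)
    (x : Space d) :
    ∫⁻ y, kernel b (x - y) ∂(densityMeasure φ) = ENNReal.ofReal (potential b φ x) := by
  have hm : Measurable fun y => kernel b (x - y) :=
    measurable_kernel.comp (measurable_const.sub measurable_id)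
  rw [densityMeasure, lintegral_withDensity_eq_lintegral_mul _ hφ.measurable.ennreal_ofReal hm,
    potential, ofReal_integral_eq_lintegral_ofReal (integrable_rieszReal_mul hd hb hφ hc x)
      (Eventually.of_forall fun y => mul_nonneg (rieszReal_nonneg hb0 _) (h0 y))]
  refine lintegral_congr_ae ?_
  filter_upwards [ae_sub_ne_zero hd x] with y hy
  rw [Pi.mul_apply, kernel_of_ne_zero hy, ENNReal.ofReal_mul (rieszReal_nonneg hb0 _), mul_comm]

lemma potential_nonneg (hb0 : b < 0) {φ : Space d → ℝ} (h0 : ∀ x, 0 ≤ φ x) (x : Space d) :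
    0 ≤ potential b φ x :=
  integral_nonneg fun y => mul_nonneg (rieszReal_nonneg hb0 _) (h0 y)

lemma conv_densityMeasure (hd : 3 ≤ d) (hb : 2 - (d : ℝ) < b) (hb0 : b < 0)
    {φ : Space d → ℝ} (hφ : Continuous φ) (hc : HasCompactSupport φ) (h0 : ∀ x, 0 ≤ φ x)
    (x : Space d) :
    conv (riesz b) (densityMeasure φ) x = (potential b φ x : EReal) := by
  rw [conv_riesz hb0, lintegral_kernel_densityMeasure hd hb hb0 hφ hc h0,
    EReal.coe_ennreal_ofReal, max_eq_left (potential_nonneg hb0 h0 x)]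

/-- A nonzero continuous density has a strictly positive potential everywhere. -/
lemma potential_pos (hd : 3 ≤ d) (hb : 2 - (d : ℝ) < b) (hb0 : b < 0)
    {φ : Space d → ℝ} (hφ : Continuous φ) (hc : HasCompactSupport φ) (h0 : ∀ x, 0 ≤ φ x)
    (h1 : ∫ x, φ x = 1) (x : Space d) : 0 < potential b φ x := by
  refine lt_of_le_of_ne (potential_nonneg hb0 h0 x) fun h => ?_
  have h2 := (integral_eq_zero_iff_of_nonneg
    (fun y => mul_nonneg (rieszReal_nonneg hb0 (x - y)) (h0 y))
    (integrable_rieszReal_mul hd hb hφ hc x)).1 h.symm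
  have h3 : φ =ᵐ[volume] fun _ => 0 := by
    filter_upwards [h2, ae_sub_ne_zero hd x] with y hy hne
    exact (mul_eq_zero.1 hy).resolve_left (rieszReal_pos hb0 hne).ne'
  rw [integral_congr_ae h3] at h1
  simp at h1

/-- Two vectors of equal length are exchanged by a linear isometry, so that integrals of
functions of the norm are rotation invariant. -/
lemma exists_linearIsometryEquiv {x y : Space d} (h : ‖x‖ = ‖y‖) :
    ∃ T : Space d ≃ₗᵢ[ℝ] Space d, T x = y :=
  ⟨_, Submodule.reflection_sub h⟩

lemma isRadial_potential {φ : Space d → ℝ} (hφ : IsRadial φ) : IsRadial (potential b φ) := by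
  intro x y h
  obtain ⟨T, rfl⟩ := exists_linearIsometryEquiv h
  rw [potential, potential,
    ← T.measurePreserving.integral_comp T.toHomeomorph.measurableEmbedding
      (fun z => rieszReal b (T x - z) * φ z)]
  refine integral_congr_ae (Eventually.of_forall fun z => ?_)
  simp only [rieszReal, ← map_sub, T.norm_map]
  rw [hφ z (T z) (T.norm_map z).symm]

lemma tendsto_potential (hd : 3 ≤ d) (hb : 2 - (d : ℝ) < b) (hb0 : b < 0)
    {φ : Space d → ℝ} (hφ : Continuous φ) (h0 : ∀ x, 0 ≤ φ x)
    (hs : tsupport φ ⊆ closedBall 0 1) (h1 : ∫ x, φ x = 1) :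
    Tendsto (potential b φ) (cocompact (Space d)) (𝓝 0) := by
  have hc : HasCompactSupport φ := (isCompact_closedBall 0 1).of_isClosed_subset
    (isClosed_tsupport φ) hs
  have hlim : Tendsto (fun x : Space d => (‖x‖ - 1) ^ b / (-b)) (cocompact (Space d)) (𝓝 0) := by
    have h := (tendsto_rpow_neg_atTop (y := -b) (by linarith)).comp
      (tendsto_atTop_add_const_right _ (-1 : ℝ) (tendsto_norm_cocompact_atTop (E := Space d)))
    simpa [Function.comp_def, sub_eq_add_neg] using h.div_const (-b)
  refine squeeze_zero' (Eventually.of_forall (potential_nonneg hb0 h0)) ?_ hlim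
  filter_upwards [(tendsto_norm_cocompact_atTop (E := Space d)).eventually_gt_atTop 1] with x hx
  have hle : ∀ y, rieszReal b (x - y) * φ y ≤ (‖x‖ - 1) ^ b / (-b) * φ y := by
    intro y
    by_cases hy : φ y = 0
    · simp [hy]
    · refine mul_le_mul_of_nonneg_right ?_ (h0 y)
      have hy1 : ‖y‖ ≤ 1 := by simpa using hs (subset_tsupport φ hy)
      have hxy : ‖x‖ - 1 ≤ ‖x - y‖ := by linarith [norm_sub_norm_le x y]
      rw [rieszReal, neg_div, ← div_neg]
      exact div_le_div_of_nonneg_right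
        (Real.rpow_le_rpow_of_nonpos (by linarith) hxy hb0.le) (by linarith)
  calc potential b φ x ≤ ∫ y, (‖x‖ - 1) ^ b / (-b) * φ y :=
        integral_mono (integrable_rieszReal_mul hd hb hφ hc x)
          ((hφ.integrable_of_hasCompactSupport hc).const_mul _) hle
    _ = (‖x‖ - 1) ^ b / (-b) := by rw [integral_const_mul, h1, mul_one]

/-! ### Strict decrease of the potential under dilation of the density -/

lemma hasFDerivAt_normSq_add_rpow {a : ℝ} (r : ℝ) {z : Space d} (hz : 0 < ‖z‖ ^ 2 + a) :
    HasFDerivAt (fun y : Space d => (‖y‖ ^ 2 + a) ^ r)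
      ((2 * r * (‖z‖ ^ 2 + a) ^ (r - 1)) • innerSL ℝ z) z := by
  have h1 : HasFDerivAt (fun y : Space d => ‖y‖ ^ 2 + a) (2 • innerSL ℝ z) z :=
    (hasStrictFDerivAt_norm_sq z).hasFDerivAt.add_const a
  have h2 := (Real.hasDerivAt_rpow_const (p := r) (Or.inl hz.ne')).comp_hasFDerivAt z h1
  refine h2.congr_fderiv ?_
  ext v
  simp
  ring

/-- The `i`-th component of the vector field `(|z|² + a)^r z`. -/
def radialField (a r : ℝ) (i : Fin d) (z : Space d) : ℝ := (‖z‖ ^ 2 + a) ^ r * z i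

/-- The divergence of the vector field `(|z|² + a)^r z`. -/
def radialDiv (a r : ℝ) (z : Space d) : ℝ :=
  d * (‖z‖ ^ 2 + a) ^ r + 2 * r * (‖z‖ ^ 2 + a) ^ (r - 1) * ‖z‖ ^ 2

lemma hasFDerivAt_radialField {a : ℝ} (r : ℝ) (i : Fin d) {z : Space d} (hz : 0 < ‖z‖ ^ 2 + a) :
    HasFDerivAt (radialField a r i)
      ((‖z‖ ^ 2 + a) ^ r • (EuclideanSpace.proj i : Space d →L[ℝ] ℝ) +
        z i • ((2 * r * (‖z‖ ^ 2 + a) ^ (r - 1)) • innerSL ℝ z)) z :=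
  (hasFDerivAt_normSq_add_rpow r hz).mul
    (EuclideanSpace.proj i : Space d →L[ℝ] ℝ).hasFDerivAt

lemma sum_fderiv_radialField {a : ℝ} (r : ℝ) {z : Space d} (hz : 0 < ‖z‖ ^ 2 + a) :
    ∑ i, fderiv ℝ (radialField a r i) z (EuclideanSpace.single i 1) = radialDiv a r z := by
  have h : ∀ i : Fin d, fderiv ℝ (radialField a r i) z (EuclideanSpace.single i 1) =
      (‖z‖ ^ 2 + a) ^ r + 2 * r * (‖z‖ ^ 2 + a) ^ (r - 1) * (z i) ^ 2 := by
    intro i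
    rw [(hasFDerivAt_radialField r i hz).fderiv]
    simp [EuclideanSpace.inner_single_right]
    ring
  rw [Finset.sum_congr rfl fun i _ => h i, Finset.sum_add_distrib, ← Finset.mul_sum,
    radialDiv, EuclideanSpace.real_norm_sq_eq]
  simp

/-- The divergence of `(|z|² + a)^(b/2 - 1) z` is bounded below by `(d + b - 2)` times its
coefficient. This is where the superharmonicity condition `b > 2 - d` enters. -/
lemma le_radialDiv (hb0 : b < 0) {a : ℝ} (ha : 0 ≤ a) {z : Space d} (hz : 0 < ‖z‖ ^ 2 + a) :
    (d + b - 2) * (‖z‖ ^ 2 + a) ^ (b / 2 - 1) ≤ radialDiv a (b / 2 - 1) z := by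
  have h1 : (‖z‖ ^ 2 + a) ^ (b / 2 - 1) =
      (‖z‖ ^ 2 + a) ^ (b / 2 - 1 - 1) * (‖z‖ ^ 2 + a) := by
    rw [← Real.rpow_add_one hz.ne']
    congr 1
    ring
  have h2 : 0 ≤ (‖z‖ ^ 2 + a) ^ (b / 2 - 1 - 1) := Real.rpow_nonneg hz.le _
  rw [radialDiv, h1]
  nlinarith [mul_nonneg h2 (mul_nonneg ha (by linarith : (0 : ℝ) ≤ 2 - b))]

/-- The smooth regularization `-(|z|² + a)^(b/2) / b` of the Riesz kernel. -/
def rieszReg (b a : ℝ) (z : Space d) : ℝ := (‖z‖ ^ 2 + a) ^ (b / 2) / (-b)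

lemma hasFDerivAt_rieszReg (hb0 : b < 0) {a : ℝ} {z : Space d} (hz : 0 < ‖z‖ ^ 2 + a) :
    HasFDerivAt (rieszReg b a) (-(‖z‖ ^ 2 + a) ^ (b / 2 - 1) • innerSL ℝ z) z := by
  have h := (hasFDerivAt_normSq_add_rpow (b / 2) hz).mul_const (-b)⁻¹
  simp only [← div_eq_mul_inv] at h
  refine h.congr_fderiv ?_
  rw [smul_smul]
  congr 1
  have hb1 : b ≠ 0 := hb0.ne
  field_simp

/-- A radial density `φ` satisfies `y φ(y) = -∇Ψ(y)` with
`Ψ(y) = ∫_{|y|}^∞ t φ(t) dt ≥ 0`, which has compact support. -/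
lemma exists_radial_primitive (hd : 3 ≤ d) {φ : Space d → ℝ} (hφ : Continuous φ)
    (hr : IsRadial φ) (h0 : ∀ x, 0 ≤ φ x) (hs : tsupport φ ⊆ closedBall 0 1)
    (h1 : ∫ x, φ x = 1) :
    ∃ Ψ : Space d → ℝ, (∀ y, HasFDerivAt Ψ (-(φ y) • innerSL ℝ y) y) ∧ (∀ y, 0 ≤ Ψ y) ∧
      (∀ y, Ψ y ≠ 0 → ‖y‖ ≤ 1) ∧ 0 < ∫ y, Ψ y := by
  have hne : Nonempty (Fin d) := ⟨⟨0, by omega⟩⟩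
  obtain ⟨e, he⟩ : ∃ e : Space d, ‖e‖ = 1 := exists_norm_eq _ zero_le_one
  -- With `s = t²` the primitive becomes a function of `|y|²`, which is differentiable at `0` too.
  set f : ℝ → ℝ := fun s => φ (Real.sqrt s • e) with hf
  have hfc : Continuous f := hφ.comp (Real.continuous_sqrt.smul continuous_const)
  have hf0 : ∀ s, 0 ≤ f s := fun s => h0 _
  have hf1 : ∀ s, 1 < s → f s = 0 := by
    intro s hs1
    by_contra h
    have h2 := hs (subset_tsupport φ h)
    rw [mem_closedBall_zero_iff, norm_smul, he, mul_one, Real.norm_eq_abs,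
      abs_of_nonneg (Real.sqrt_nonneg s), Real.sqrt_le_iff] at h2
    linarith [h2.2]
  have hF1 : ∀ u, 1 ≤ u → ∫ s in u..1, f s = 0 := by
    intro u hu
    rw [intervalIntegral.integral_symm, intervalIntegral.integral_of_le hu,
      setIntegral_eq_zero_of_forall_eq_zero fun s hs1 => hf1 s hs1.1, neg_zero]
  set Ψ : Space d → ℝ := fun y => (1 / 2) * ∫ s in (‖y‖ ^ 2)..1, f s with hΨ
  have hder : ∀ y, HasFDerivAt Ψ (-(φ y) • innerSL ℝ y) y := by
    intro y
    have hF : HasDerivAt (fun u => ∫ s in u..1, f s) (-f (‖y‖ ^ 2)) (‖y‖ ^ 2) :=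
      intervalIntegral.integral_hasDerivAt_left (hfc.intervalIntegrable _ _)
        (hfc.stronglyMeasurableAtFilter _ _) hfc.continuousAt
    have h2 := (hF.comp_hasFDerivAt y (hasStrictFDerivAt_norm_sq y).hasFDerivAt).const_mul (1 / 2)
    refine h2.congr_fderiv ?_
    have hfy : f (‖y‖ ^ 2) = φ y := by
      refine hr _ _ ?_
      rw [norm_smul, he, mul_one, Real.sqrt_sq (norm_nonneg y), norm_norm]
    rw [hfy]
    ext v
    simp
    ring
  have hpos : ∀ y, 0 ≤ Ψ y := by
    intro y
    rcases le_total (‖y‖ ^ 2) 1 with h | h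
    · exact mul_nonneg (by norm_num) (intervalIntegral.integral_nonneg h fun s _ => hf0 s)
    · simp [hΨ, hF1 _ h]
  have hsupp : ∀ y, Ψ y ≠ 0 → ‖y‖ ≤ 1 := by
    intro y hy
    by_contra! h
    exact hy (by simp [hΨ, hF1 (‖y‖ ^ 2) (by nlinarith)])
  have hc : HasCompactSupport Ψ := HasCompactSupport.intro (isCompact_closedBall 0 1)
    fun y hy => by
      by_contra h
      exact hy (mem_closedBall_zero_iff.2 (hsupp y h))
  have hcont : Continuous Ψ := continuous_iff_continuousAt.2 fun y => (hder y).continuousAt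
  refine ⟨Ψ, hder, hpos, hsupp, ?_⟩
  refine lt_of_le_of_ne (integral_nonneg hpos) fun h => ?_
  have hz : Ψ =ᵐ[volume] 0 :=
    (integral_eq_zero_iff_of_nonneg hpos (hcont.integrable_of_hasCompactSupport hc)).1 h.symm
  have hz' : Ψ = 0 := (hcont.ae_eq_iff_eq volume continuous_const).1 hz
  have hφ0 : ∀ᵐ y, φ y = 0 := by
    filter_upwards [ae_sub_ne_zero hd 0] with y hy
    have h3 : -(φ y) • innerSL ℝ y = 0 := by
      rw [← (hder y).fderiv, hz']
      simp
    have h4 := congrArg (fun l => l y) h3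
    simpa [show y ≠ 0 by simpa using hy] using h4
  rw [integral_congr_ae hφ0] at h1
  simp at h1

lemma normSq_add_pos {a : ℝ} (ha : 0 < a) (z : Space d) : 0 < ‖z‖ ^ 2 + a := by positivity

lemma continuous_normSq_add_rpow {a : ℝ} (ha : 0 < a) (r : ℝ) :
    Continuous fun z : Space d => (‖z‖ ^ 2 + a) ^ r :=
  continuous_iff_continuousAt.2 fun z =>
    (hasFDerivAt_normSq_add_rpow r (normSq_add_pos ha z)).continuousAt

lemma continuous_rieszReg {a : ℝ} (ha : 0 < a) : Continuous (rieszReg b a : Space d → ℝ) :=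
  (continuous_normSq_add_rpow ha _).div_const _

/-- Integration by parts turns `∫ ∇W_a(x - t y) · y φ(y) dy` into the integral of
`-t ΔW_a(x - t y) Ψ(y)`, where `W_a` is the regularized kernel and `-∇Ψ = y φ(y)`. -/
lemma integral_radialField_mul {a r : ℝ} (ha : 0 < a) {φ Ψ : Space d → ℝ}
    (hφ : Continuous φ) (hs : tsupport φ ⊆ closedBall 0 1)
    (hΨ : ∀ y, HasFDerivAt Ψ (-(φ y) • innerSL ℝ y) y) (hc : HasCompactSupport Ψ)
    (x : Space d) (t : ℝ) :
    ∫ y, (‖x - t • y‖ ^ 2 + a) ^ r * inner ℝ (x - t • y) y * φ y =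
      -(t * ∫ y, radialDiv a r (x - t • y) * Ψ y) := by
  have hcφ : HasCompactSupport φ := (isCompact_closedBall 0 1).of_isClosed_subset
    (isClosed_tsupport φ) hs
  have hΨc : Continuous Ψ := continuous_iff_continuousAt.2 fun y => (hΨ y).continuousAt
  have hz : Continuous fun y : Space d => x - t • y := by fun_prop
  have hq : ∀ s : ℝ, Continuous fun y : Space d => (‖x - t • y‖ ^ 2 + a) ^ s := fun s =>
    (continuous_normSq_add_rpow ha s).comp hz
  have hG : ∀ (i : Fin d) (y : Space d), HasFDerivAt (fun y => radialField a r i (x - t • y))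
      (-t • fderiv ℝ (radialField a r i) (x - t • y)) y := by
    intro i y
    have h1 : HasFDerivAt (fun y : Space d => x - t • y)
        (-(t • ContinuousLinearMap.id ℝ (Space d))) y :=
      ((hasFDerivAt_id y).const_smul t).const_sub x
    have h2 := (hasFDerivAt_radialField (a := a) r i (normSq_add_pos ha (x - t • y)))
    rw [h2.fderiv]
    refine (h2.comp y h1).congr_fderiv ?_
    ext v
    simp
    ring
  have hGd : ∀ (i : Fin d) (y : Space d),
      fderiv ℝ (radialField a r i) (x - t • y) (EuclideanSpace.single i 1) =
      (‖x - t • y‖ ^ 2 + a) ^ r +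
        (x - t • y) i * (2 * r * (‖x - t • y‖ ^ 2 + a) ^ (r - 1) * (x - t • y) i) := by
    intro i y
    rw [(hasFDerivAt_radialField r i (normSq_add_pos ha _)).fderiv]
    simp [EuclideanSpace.inner_single_right]
  have hzi : ∀ i : Fin d, Continuous fun y : Space d => (x - t • y) i := fun i =>
    (EuclideanSpace.proj i : Space d →L[ℝ] ℝ).continuous.comp hz
  have hyi : ∀ i : Fin d, Continuous fun y : Space d => y i := fun i =>
    (EuclideanSpace.proj i : Space d →L[ℝ] ℝ).continuous
  have hGdc : ∀ i : Fin d, Continuous fun y : Space d =>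
      fderiv ℝ (radialField a r i) (x - t • y) (EuclideanSpace.single i 1) := by
    intro i
    simp only [hGd]
    exact (hq r).add ((hzi i).mul ((continuous_const.mul (hq (r - 1))).mul (hzi i)))
  have hGc : ∀ i : Fin d, Continuous fun y : Space d => radialField a r i (x - t • y) :=
    fun i => (hq r).mul (hzi i)
  have hΨd : ∀ (i : Fin d) (y : Space d),
      fderiv ℝ Ψ y (EuclideanSpace.single i 1) = -(y i * φ y) := by
    intro i y
    rw [(hΨ y).fderiv]
    simp [EuclideanSpace.inner_single_right]
    ring
  have hint1 : ∀ i : Fin d, Integrable fun y : Space d =>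
      radialField a r i (x - t • y) * (y i * φ y) := fun i =>
    ((hGc i).mul ((hyi i).mul hφ)).integrable_of_hasCompactSupport (hcφ.mul_left.mul_left)
  have hint2 : ∀ i : Fin d, Integrable fun y : Space d =>
      fderiv ℝ (radialField a r i) (x - t • y) (EuclideanSpace.single i 1) * Ψ y := fun i =>
    ((hGdc i).mul hΨc).integrable_of_hasCompactSupport hc.mul_left
  have hparts : ∀ i : Fin d, ∫ y, radialField a r i (x - t • y) * (y i * φ y) =
      -(t * ∫ y, fderiv ℝ (radialField a r i) (x - t • y) (EuclideanSpace.single i 1) * Ψ y) := by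
    intro i
    have h := integral_mul_fderiv_eq_neg_fderiv_mul_of_integrable
      (μ := (volume : Measure (Space d))) (f := fun y => radialField a r i (x - t • y)) (g := Ψ) (v := EuclideanSpace.single i 1)
      (by
        simp only [(hG i _).fderiv]
        refine ((hint2 i).const_mul (-t)).congr (Eventually.of_forall fun y => ?_)
        simp [mul_assoc])
      (by
        simp only [hΨd]
        refine (hint1 i).neg.congr (Eventually.of_forall fun y => ?_)
        simp)
      (((hGc i).mul hΨc).integrable_of_hasCompactSupport hc.mul_left)
      (fun y _ => (hG i y).differentiableAt) (fun y _ => (hΨ y).differentiableAt)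
    simp only [hΨd, (hG i _).fderiv, smul_apply, smul_eq_mul, mul_neg,
      mul_assoc, integral_neg, integral_const_mul] at h
    linarith
  calc ∫ y, (‖x - t • y‖ ^ 2 + a) ^ r * inner ℝ (x - t • y) y * φ y
      = ∫ y, ∑ i, radialField a r i (x - t • y) * (y i * φ y) := by
        congr 1
        funext y
        rw [PiLp.inner_apply, Finset.mul_sum, Finset.sum_mul]
        refine Finset.sum_congr rfl fun i _ => ?_
        simp [radialField]
        ring
    _ = ∑ i, -(t * ∫ y,
          fderiv ℝ (radialField a r i) (x - t • y) (EuclideanSpace.single i 1) * Ψ y) := by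
        rw [integral_finsetSum _ fun i _ => hint1 i]
        exact Finset.sum_congr rfl fun i _ => hparts i
    _ = -(t * ∫ y, radialDiv a r (x - t • y) * Ψ y) := by
        rw [Finset.sum_neg_distrib, ← Finset.mul_sum, ← integral_finsetSum _ fun i _ => hint2 i]
        simp only [← Finset.sum_mul]
        congr 3
        funext y
        rw [sum_fderiv_radialField r (normSq_add_pos ha _)]

lemma hasDerivAt_integral_rieszReg (hb0 : b < 0) {a : ℝ} (ha : 0 < a) {φ : Space d → ℝ}
    (hφ : Continuous φ) (hs : tsupport φ ⊆ closedBall 0 1) (x : Space d) (t : ℝ) :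
    HasDerivAt (fun t => ∫ y, rieszReg b a (x - t • y) * φ y)
      (∫ y, (‖x - t • y‖ ^ 2 + a) ^ (b / 2 - 1) * inner ℝ (x - t • y) y * φ y) t := by
  have hcφ : HasCompactSupport φ := (isCompact_closedBall 0 1).of_isClosed_subset
    (isClosed_tsupport φ) hs
  have hz : ∀ t : ℝ, Continuous fun y : Space d => x - t • y := fun t => by fun_prop
  have hV : ∀ t : ℝ, Continuous fun y : Space d => rieszReg b a (x - t • y) * φ y := fun t =>
    ((continuous_rieszReg ha).comp (hz t)).mul hφ
  have hV' : ∀ t : ℝ, Continuous fun y : Space d =>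
      (‖x - t • y‖ ^ 2 + a) ^ (b / 2 - 1) * inner ℝ (x - t • y) y * φ y := fun t =>
    (((continuous_normSq_add_rpow ha _).comp (hz t)).mul
      ((hz t).inner continuous_id)).mul hφ
  refine (hasDerivAt_integral_of_dominated_loc_of_deriv_le (μ := volume)
    (F := fun t y => rieszReg b a (x - t • y) * φ y)
    (F' := fun t y => (‖x - t • y‖ ^ 2 + a) ^ (b / 2 - 1) * inner ℝ (x - t • y) y * φ y)
    (bound := fun y => a ^ (b / 2 - 1) * (‖x‖ + (|t| + 1)) * |φ y|)
    (ball_mem_nhds t one_pos)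
    (Eventually.of_forall fun s => (hV s).aestronglyMeasurable)
    ((hV t).integrable_of_hasCompactSupport hcφ.mul_left)
    (hV' t).aestronglyMeasurable
    (Eventually.of_forall fun y s hst => ?_)
    ((hφ.abs.integrable_of_hasCompactSupport hcφ.norm).const_mul _)
    (Eventually.of_forall fun y s _ => ?_)).2
  · by_cases hy : φ y = 0
    · simp [hy]
    have hy1 : ‖y‖ ≤ 1 := by simpa using hs (subset_tsupport φ hy)
    have hs1 : |s| ≤ |t| + 1 := by
      rw [mem_ball, Real.dist_eq] at hst
      have := abs_add_le (s - t) t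
      rw [sub_add_cancel] at this
      linarith
    rw [norm_mul, norm_mul, Real.norm_eq_abs, Real.norm_eq_abs (φ y),
      abs_of_nonneg (Real.rpow_nonneg (normSq_add_pos ha _).le _)]
    refine mul_le_mul_of_nonneg_right (mul_le_mul ?_ ?_ (norm_nonneg _)
      (Real.rpow_nonneg ha.le _)) (abs_nonneg _)
    · exact Real.rpow_le_rpow_of_nonpos ha (by nlinarith [sq_nonneg ‖x - s • y‖]) (by linarith)
    · calc ‖inner ℝ (x - s • y) y‖ ≤ ‖x - s • y‖ * ‖y‖ := norm_inner_le_norm _ _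
        _ ≤ ‖x - s • y‖ * 1 := mul_le_mul_of_nonneg_left hy1 (norm_nonneg _)
        _ ≤ ‖x‖ + ‖s • y‖ := by rw [mul_one]; exact norm_sub_le _ _
        _ ≤ ‖x‖ + (|t| + 1) := by
          rw [norm_smul, Real.norm_eq_abs]
          nlinarith [abs_nonneg s, norm_nonneg y]
  · have h1 : HasDerivAt (fun s : ℝ => x - s • y) (-y) s := by
      simpa using ((hasDerivAt_id s).smul_const y).const_sub x
    have h2 := ((hasFDerivAt_rieszReg hb0 (normSq_add_pos ha (x - s • y))).comp_hasDerivAt s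
      h1).mul_const (φ y)
    refine h2.congr_deriv ?_
    rw [smul_apply, innerSL_apply_apply, inner_neg_right, smul_eq_mul]
    ring

/-- The regularized potentials at `x` of the density dilated by `2` and of the density itself
differ by a negative amount that does not depend on the regularization. -/
lemma integral_rieszReg_two_le (hb : 2 - (d : ℝ) < b) (hb0 : b < 0) {a : ℝ}
    (ha : 0 < a) (ha1 : a ≤ 1) {φ Ψ : Space d → ℝ}
    (hφ : Continuous φ) (hs : tsupport φ ⊆ closedBall 0 1)
    (hΨ : ∀ y, HasFDerivAt Ψ (-(φ y) • innerSL ℝ y) y) (hΨ0 : ∀ y, 0 ≤ Ψ y)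
    (hΨ1 : ∀ y, Ψ y ≠ 0 → ‖y‖ ≤ 1) (x : Space d) :
    ∫ y, rieszReg b a (x - (2 : ℝ) • y) * φ y ≤ (∫ y, rieszReg b a (x - y) * φ y) -
      (d + b - 2) * ((‖x‖ + 2) ^ 2 + 1) ^ (b / 2 - 1) * ∫ y, Ψ y := by
  set κ : ℝ := (d + b - 2) * ((‖x‖ + 2) ^ 2 + 1) ^ (b / 2 - 1) with hκ
  have hκ0 : 0 ≤ κ := mul_nonneg (by linarith) (by positivity)
  have hc : HasCompactSupport Ψ := HasCompactSupport.intro (isCompact_closedBall 0 1)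
    fun y hy => by
      by_contra h
      exact hy (mem_closedBall_zero_iff.2 (hΨ1 y h))
  have hΨc : Continuous Ψ := continuous_iff_continuousAt.2 fun y => (hΨ y).continuousAt
  have hderiv : ∀ t : ℝ, HasDerivAt (fun t => ∫ y, rieszReg b a (x - t • y) * φ y)
      (-(t * ∫ y, radialDiv a (b / 2 - 1) (x - t • y) * Ψ y)) t := by
    intro t
    rw [← integral_radialField_mul ha hφ hs hΨ hc x t]
    exact hasDerivAt_integral_rieszReg hb0 ha hφ hs x t
  have hle : ∀ t ∈ Set.Icc (1 : ℝ) 2,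
      -(t * ∫ y, radialDiv a (b / 2 - 1) (x - t • y) * Ψ y) ≤ -(κ * ∫ y, Ψ y) := by
    intro t ht
    have hdivc : Continuous fun y : Space d => radialDiv a (b / 2 - 1) (x - t • y) := by
      have hz : Continuous fun y : Space d => x - t • y := by fun_prop
      unfold radialDiv
      exact (continuous_const.mul ((continuous_normSq_add_rpow ha _).comp hz)).add
        ((continuous_const.mul ((continuous_normSq_add_rpow ha _).comp hz)).mul (hz.norm.pow 2))
    have h1 : κ * ∫ y, Ψ y ≤ ∫ y, radialDiv a (b / 2 - 1) (x - t • y) * Ψ y := by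
      rw [← integral_const_mul]
      refine integral_mono ((hΨc.integrable_of_hasCompactSupport hc).const_mul κ)
        ((hdivc.mul hΨc).integrable_of_hasCompactSupport hc.mul_left) fun y => ?_
      by_cases hy : Ψ y = 0
      · simp [hy]
      refine mul_le_mul_of_nonneg_right (le_trans ?_
        (le_radialDiv hb0 ha.le (normSq_add_pos ha (x - t • y)))) (hΨ0 y)
      refine mul_le_mul_of_nonneg_left (Real.rpow_le_rpow_of_nonpos
        (normSq_add_pos ha _) (add_le_add (pow_le_pow_left₀ (norm_nonneg _) ?_ 2) ha1)
        (by linarith)) (by linarith)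
      refine (norm_sub_le _ _).trans (add_le_add le_rfl ?_)
      rw [norm_smul, Real.norm_eq_abs, abs_of_nonneg (by linarith [ht.1])]
      nlinarith [hΨ1 y hy, norm_nonneg y, ht.1, ht.2]
    have h2 : 0 ≤ κ * ∫ y, Ψ y := mul_nonneg hκ0 (integral_nonneg hΨ0)
    nlinarith [ht.1]
  have h := (convex_Icc (1 : ℝ) 2).image_sub_le_mul_sub_of_deriv_le
    (f := fun t : ℝ => ∫ y, rieszReg b a (x - t • y) * φ y) (C := -(κ * ∫ y, Ψ y))
    (fun t _ => (hderiv t).continuousAt.continuousWithinAt)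
    (fun t _ => (hderiv t).differentiableAt.differentiableWithinAt)
    (fun t ht => by
      rw [(hderiv t).deriv]
      exact hle t (interior_subset ht))
    1 (by norm_num) 2 (by norm_num) (by norm_num)
  simp only [one_smul] at h
  linarith

/-- The regularized kernels increase to the Riesz kernel, so their potentials converge. -/
lemma tendsto_integral_rieszReg (hb0 : b < 0) {φ : Space d → ℝ} {T : Space d → Space d}
    (hφ : Continuous φ) (hT : Continuous T) (hT0 : ∀ᵐ y, T y ≠ 0)
    (hint : Integrable fun y => rieszReal b (T y) * φ y) :
    Tendsto (fun n : ℕ => ∫ y, rieszReg b (1 / ((n : ℝ) + 1)) (T y) * φ y) atTop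
      (𝓝 (∫ y, rieszReal b (T y) * φ y)) := by
  have hn : ∀ n : ℕ, (0 : ℝ) < 1 / ((n : ℝ) + 1) := fun n => by positivity
  refine tendsto_integral_of_dominated_convergence (fun y => |rieszReal b (T y) * φ y|)
    (fun n => (((continuous_rieszReg (hn n)).comp hT).mul hφ).aestronglyMeasurable) hint.abs
    (fun n => ?_) ?_
  · filter_upwards [hT0] with y hy
    have hp : 0 < ‖T y‖ := norm_pos_iff.2 hy
    rw [Real.norm_eq_abs, abs_mul, abs_mul]
    refine mul_le_mul_of_nonneg_right ?_ (abs_nonneg _)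
    have h1 : (‖T y‖ ^ 2) ^ (b / 2) = ‖T y‖ ^ b := by
      rw [← Real.rpow_natCast, ← Real.rpow_mul hp.le]
      congr 1
      push_cast
      ring
    rw [abs_of_nonneg (rieszReal_nonneg hb0 _), rieszReg, abs_of_nonneg (div_nonneg
      (Real.rpow_nonneg (normSq_add_pos (hn n) _).le _) (by linarith)), rieszReal, neg_div,
      ← div_neg, ← h1]
    exact div_le_div_of_nonneg_right (Real.rpow_le_rpow_of_nonpos (by positivity)
      (by linarith [hn n]) (by linarith)) (by linarith)
  · filter_upwards [hT0] with y hy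
    have hp : 0 < ‖T y‖ := norm_pos_iff.2 hy
    have h1 : (‖T y‖ ^ 2 + 0) ^ (b / 2) = ‖T y‖ ^ b := by
      rw [add_zero, ← Real.rpow_natCast, ← Real.rpow_mul hp.le]
      congr 1
      push_cast
      ring
    refine Tendsto.mul_const _ ?_
    unfold rieszReg rieszReal
    rw [neg_div, ← div_neg, ← h1]
    refine Tendsto.div_const (Tendsto.rpow_const
      (tendsto_one_div_add_atTop_nhds_zero_nat.const_add _) (Or.inl ?_)) _
    positivity

/-- The density of `2 Y` when `Y` has density `φ`. -/
def dilate (φ : Space d → ℝ) (x : Space d) : ℝ := (2 ^ d)⁻¹ * φ ((2 : ℝ)⁻¹ • x)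

lemma potential_dilate (φ : Space d → ℝ) (x : Space d) :
    potential b (dilate φ) x = ∫ y, rieszReal b (x - (2 : ℝ) • y) * φ y := by
  have h := Measure.integral_comp_smul (μ := (volume : Measure (Space d)))
    (fun y => rieszReal b (x - y) * φ ((2 : ℝ)⁻¹ • y)) 2
  simp only [smul_smul, inv_mul_cancel₀ (two_ne_zero (α := ℝ)), one_smul, finrank_euclideanSpace,
    Fintype.card_fin, smul_eq_mul, ← integral_const_mul] at h
  rw [h, potential]
  congr 1
  funext y
  rw [dilate, abs_of_nonneg (by positivity)]
  ring

lemma continuous_dilate {φ : Space d → ℝ} (hφ : Continuous φ) : Continuous (dilate φ) := by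
  unfold dilate
  fun_prop

lemma hasCompactSupport_dilate {φ : Space d → ℝ} (hc : HasCompactSupport φ) :
    HasCompactSupport (dilate φ) :=
  (hc.comp_smul (inv_ne_zero two_ne_zero)).mul_left

/-- Spreading out a radial density strictly lowers its potential everywhere. -/
lemma potential_dilate_lt (hd : 3 ≤ d) (hb : 2 - (d : ℝ) < b) (hb0 : b < 0)
    {φ : Space d → ℝ} (hφ : Continuous φ) (hr : IsRadial φ) (h0 : ∀ x, 0 ≤ φ x)
    (hs : tsupport φ ⊆ closedBall 0 1) (h1 : ∫ x, φ x = 1) (x : Space d) :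
    potential b (dilate φ) x < potential b φ x := by
  have hc : HasCompactSupport φ := (isCompact_closedBall 0 1).of_isClosed_subset
    (isClosed_tsupport φ) hs
  obtain ⟨Ψ, hΨ, hΨ0, hΨ1, hΨpos⟩ := exists_radial_primitive hd hφ hr h0 hs h1
  have hT0 : ∀ᵐ y : Space d, x - (2 : ℝ) • y ≠ 0 := by
    filter_upwards [ae_sub_ne_zero hd ((2 : ℝ)⁻¹ • x)] with y hy h
    apply hy
    rw [sub_eq_zero.1 h, smul_smul, inv_mul_cancel₀ two_ne_zero, one_smul, sub_self]
  have hint : Integrable fun y => rieszReal b (x - (2 : ℝ) • y) * φ y := by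
    have h := (integrable_rieszReal_mul hd hb (continuous_dilate hφ)
      (hasCompactSupport_dilate hc) x).comp_smul (two_ne_zero (α := ℝ))
    refine (h.const_mul (2 ^ d)).congr (Eventually.of_forall fun y => ?_)
    simp only [dilate, smul_smul, inv_mul_cancel₀ (two_ne_zero (α := ℝ)), one_smul]
    field_simp
  have hlim2 := tendsto_integral_rieszReg hb0 hφ (by fun_prop) hT0 hint
  have hlim1 := tendsto_integral_rieszReg hb0 hφ (T := fun y => x - y) (by fun_prop)
    (ae_sub_ne_zero hd x) (integrable_rieszReal_mul hd hb hφ hc x)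
  have hle := le_of_tendsto_of_tendsto' hlim2 (hlim1.sub_const _) fun n =>
    integral_rieszReg_two_le hb hb0 (a := 1 / ((n : ℝ) + 1)) (by positivity)
      (by rw [div_le_one (by positivity)]; linarith [(Nat.cast_nonneg n : (0 : ℝ) ≤ n)])
      hφ hs hΨ hΨ0 hΨ1 x
  rw [potential_dilate, potential]
  have hκ : 0 < (d + b - 2) * ((‖x‖ + 2) ^ 2 + 1) ^ (b / 2 - 1) * ∫ y, Ψ y :=
    mul_pos (mul_pos (by linarith) (by positivity)) hΨpos
  linarith

/-! ### Subthreshold densities -/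

lemma IsMollifier.hasCompactSupport {φ : Space d → ℝ} (h : IsMollifier φ) :
    HasCompactSupport φ :=
  (isCompact_closedBall 0 1).of_isClosed_subset (isClosed_tsupport φ) h.supported

lemma IsMollifier.isRadial {φ : Space d → ℝ} (h : IsMollifier φ) : IsRadial φ := fun x y hxy =>
  le_antisymm (h.radially_decreasing y x hxy.ge) (h.radially_decreasing x y hxy.le)

lemma isProbabilityMeasure_densityMeasure {φ : Space d → ℝ} (hφ : Continuous φ)
    (hc : HasCompactSupport φ) (h0 : ∀ x, 0 ≤ φ x) (h1 : ∫ x, φ x = 1) :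
    IsProbabilityMeasure (densityMeasure φ) := by
  constructor
  rw [densityMeasure, withDensity_apply _ MeasurableSet.univ, Measure.restrict_univ,
    ← ofReal_integral_eq_lintegral_ofReal (hφ.integrable_of_hasCompactSupport hc)
      (Eventually.of_forall h0), h1, ENNReal.ofReal_one]

/-- The support of a radially decreasing function is a closed ball. -/
lemma exists_tsupport_eq_closedBall (hd : 3 ≤ d) {φ : Space d → ℝ} (hφ : Continuous φ)
    (hc : HasCompactSupport φ) (h0 : ∀ x, 0 ≤ φ x) (hdec : ∀ x y, ‖x‖ ≤ ‖y‖ → φ y ≤ φ x)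
    (h1 : ∫ x, φ x = 1) : ∃ R : ℝ, 0 < R ∧ tsupport φ = closedBall 0 R := by
  have hne : Nonempty (Fin d) := ⟨⟨0, by omega⟩⟩
  set S : Set ℝ := (fun x : Space d => ‖x‖) '' Function.support φ with hS
  have hbdd : BddAbove S := by
    obtain ⟨C, hC⟩ := hc.isCompact.isBounded.exists_norm_le
    refine ⟨C, ?_⟩
    rintro _ ⟨x, hx, rfl⟩
    exact hC x (subset_tsupport φ hx)
  have hφ0 : 0 < φ 0 := by
    refine lt_of_le_of_ne (h0 0) fun h => ?_
    have hz : φ = fun _ => 0 := by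
      funext x
      exact le_antisymm (h ▸ hdec 0 x (by simp)) (h0 x)
    rw [hz] at h1
    simp at h1
  obtain ⟨r, hr, hball⟩ := Metric.eventually_nhds_iff_ball.1
    (continuousAt_const.eventually_lt hφ.continuousAt hφ0)
  have hRpos : 0 < sSup S := by
    obtain ⟨e, he⟩ : ∃ e : Space d, ‖e‖ = r / 2 := exists_norm_eq _ (by positivity)
    have hmem : e ∈ ball (0 : Space d) r := by
      rw [mem_ball_zero_iff, he]
      linarith
    exact (half_pos hr).trans_le (he ▸ le_csSup hbdd ⟨e, (hball e hmem).ne', rfl⟩)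
  refine ⟨sSup S, hRpos, ?_⟩
  apply Set.Subset.antisymm
  · refine closure_minimal (fun x hx => ?_) isClosed_closedBall
    rw [mem_closedBall_zero_iff]
    exact le_csSup hbdd ⟨x, hx, rfl⟩
  · rw [← closure_ball 0 hRpos.ne']
    refine closure_mono fun x hx => ?_
    rw [mem_ball_zero_iff] at hx
    obtain ⟨_, ⟨y, hy, rfl⟩, hxy⟩ := exists_lt_of_lt_csSup
      (Set.Nonempty.image _ ⟨0, hφ0.ne'⟩) hx
    exact (((h0 y).lt_of_ne' hy).trans_le (hdec x y hxy.le)).ne'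

lemma integral_dilate (φ : Space d → ℝ) : ∫ x, dilate φ x = ∫ x, φ x := by
  have h := Measure.integral_comp_smul (μ := (volume : Measure (Space d))) φ (2 : ℝ)⁻¹
  unfold dilate
  rw [integral_const_mul, h, finrank_euclideanSpace, Fintype.card_fin, smul_eq_mul,
    abs_of_nonneg (by positivity), inv_pow, inv_inv, ← mul_assoc,
    inv_mul_cancel₀ (by positivity), one_mul]

lemma potential_pos_of_isMollifier (hd : 3 ≤ d) (hb : 2 - (d : ℝ) < b) (hb0 : b < 0)
    {φ : Space d → ℝ} (h : IsMollifier φ) (x : Space d) : 0 < potential b φ x :=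
  potential_pos hd hb hb0 h.smooth.continuous h.hasCompactSupport h.nonneg h.integral_eq_one x

lemma coe_genPotential_riesz (hd : 3 ≤ d) (hb : 2 - (d : ℝ) < b) (hb0 : b < 0)
    {ρ : Space d → ℝ} (hρ : Continuous ρ) (hc : HasCompactSupport ρ) (h0 : ∀ x, 0 ≤ ρ x)
    (U : Space d → ℝ) (x : Space d) :
    genPotential (riesz b) (fun x => (U x : EReal)) (densityMeasure ρ) x =
      ((potential b ρ x + U x : ℝ) : EReal) := by
  rw [genPotential, conv_densityMeasure hd hb hb0 hρ hc h0, EReal.coe_add]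

/-- For a mollifier `φ` the dilated density is a subthreshold density for `-α W * φ` as soon as
`α` exceeds the maximum over its support of the ratio of the two potentials. -/
lemma exists_isSubthreshold (hd : 3 ≤ d) (hb : 2 - (d : ℝ) < b) (hb0 : b < 0)
    {φ : Space d → ℝ} (h : IsMollifier φ) :
    ∃ α₀ : ℝ, 0 < α₀ ∧ α₀ < 1 ∧ ∀ α : ℝ, α₀ < α →
      ∃ (ρ : Space d → ℝ) (R : ℝ),
        IsSubthreshold (riesz b) (fun x => ((α * -potential b φ x : ℝ) : EReal)) ρ R := by
  have hφ := h.smooth.continuous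
  have hc := h.hasCompactSupport
  have hρs : ContDiff ℝ ∞ (dilate φ) :=
    contDiff_const.mul (h.smooth.comp (contDiff_const_smul _))
  have hρ := hρs.continuous
  have hρc := hasCompactSupport_dilate hc
  have hρ0 : ∀ x, 0 ≤ dilate φ x := fun x => mul_nonneg (by positivity) (h.nonneg _)
  have hρ1 : ∫ x, dilate φ x = 1 := (integral_dilate φ).trans h.integral_eq_one
  have hρdec : ∀ x y, ‖x‖ ≤ ‖y‖ → dilate φ y ≤ dilate φ x := fun x y hxy =>
    mul_le_mul_of_nonneg_left (h.radially_decreasing _ _ (by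
      rw [norm_smul, norm_smul]
      exact mul_le_mul_of_nonneg_left hxy (norm_nonneg _))) (by positivity)
  obtain ⟨R, hR, hsupp⟩ := exists_tsupport_eq_closedBall hd hρ hρc hρ0 hρdec hρ1
  have hpos := potential_pos_of_isMollifier hd hb hb0 h
  have hcφ := (contDiff_potential hd hb h.smooth hc).continuous
  have hcρ := (contDiff_potential hd hb hρs hρc).continuous
  have hne : (closedBall (0 : Space d) R).Nonempty := ⟨0, by simp [hR.le]⟩
  have hcomp : IsCompact (closedBall (0 : Space d) R) := isCompact_closedBall 0 R
  obtain ⟨x₀, -, hx₀⟩ := hcomp.exists_isMaxOn hne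
    (hcρ.div hcφ fun x => (hpos x).ne').continuousOn
  obtain ⟨x₁, -, hx₁⟩ := hcomp.exists_isMinOn hne hcφ.continuousOn
  have hlt : potential b (dilate φ) x₀ / potential b φ x₀ < 1 :=
    (div_lt_one (hpos x₀)).2 (potential_dilate_lt hd hb hb0 hφ h.isRadial h.nonneg h.supported
      h.integral_eq_one x₀)
  refine ⟨max (1 / 2) (potential b (dilate φ) x₀ / potential b φ x₀), by positivity,
    max_lt (by norm_num) hlt, fun α hα => ⟨dilate φ, R, ?_⟩⟩
  refine ⟨hR, hρs, fun x y hxy => le_antisymm (hρdec y x hxy.ge) (hρdec x y hxy.le), hρ0,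
    isProbabilityMeasure_densityMeasure hρ hρc hρ0 hρ1, hsupp, ?_, ?_⟩
  · have heq : conv (riesz b) (densityMeasure (dilate φ)) =
        fun x => (potential b (dilate φ) x : EReal) :=
      funext (conv_densityMeasure hd hb hb0 hρ hρc hρ0)
    rw [heq]
    exact continuous_coe_real_ereal.comp hcρ
  · set q : ℝ := potential b (dilate φ) x₀ / potential b φ x₀ with hq
    have hqα : q < α := (le_max_right _ _).trans_lt hα
    have hbound : ∀ x ∈ ball (0 : Space d) R,
        genPotential (riesz b) (fun x => ((α * -potential b φ x : ℝ) : EReal))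
          (densityMeasure (dilate φ)) x ≤ (((q - α) * potential b φ x₁ : ℝ) : EReal) := by
      intro x hx
      rw [coe_genPotential_riesz hd hb hb0 hρ hρc hρ0, EReal.coe_le_coe_iff]
      have h1 : potential b (dilate φ) x ≤ q * potential b φ x :=
        (div_le_iff₀ (hpos x)).1 (hx₀ (ball_subset_closedBall hx))
      have h2 : potential b φ x₁ ≤ potential b φ x := hx₁ (ball_subset_closedBall hx)
      nlinarith
    refine (iSup₂_le hbound).trans_lt ?_
    exact_mod_cast mul_neg_of_neg_of_pos (by linarith) (hpos x₁)

/-! ### Strict positive definiteness of the Riesz kernel -/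

/-- The Gaussian `exp(-2 s |x - z|²)`, indexed by its width and its centre `p = (s, z)`. -/
def gauss (p : ℝ × Space d) (x : Space d) : ENNReal :=
  ENNReal.ofReal (Real.exp (-(2 * p.1 * ‖x - p.2‖ ^ 2)))

/-- The measure on Gaussian widths `s > 0` for which the Riesz kernel is the superposition of
products of Gaussians of equal width and centre. The factor `(π / (4 s))^(d/2)` is the mass of
such a product up to its dependence on the two points. -/
def widthMeasure (d : ℕ) (b : ℝ) : Measure ℝ :=
  (volume.restrict (Set.Ioi 0)).withDensity fun s => ENNReal.ofReal
    (s ^ (-b / 2 - 1) / ((-b) * Real.Gamma (-b / 2) * (Real.pi / (4 * s)) ^ (d / 2 : ℝ)))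

/-- The measure on pairs of a width and a centre. -/
def gaussMeasure (d : ℕ) (b : ℝ) : Measure (ℝ × Space d) := (widthMeasure d b).prod volume

lemma measurable_widthDensity : Measurable fun s : ℝ => ENNReal.ofReal
    (s ^ (-b / 2 - 1) / ((-b) * Real.Gamma (-b / 2) * (Real.pi / (4 * s)) ^ (d / 2 : ℝ))) := by
  fun_prop

instance : SFinite (widthMeasure d b) := by
  unfold widthMeasure
  infer_instance

instance : SFinite (gaussMeasure d b) := by
  unfold gaussMeasure
  infer_instance

lemma measurable_gauss : Measurable fun q : (ℝ × Space d) × Space d => gauss q.1 q.2 := by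
  unfold gauss
  fun_prop

lemma lintegral_exp_neg_mul_norm_sub_sq {a : ℝ} (ha : 0 < a) (x : Space d) :
    ∫⁻ z, ENNReal.ofReal (Real.exp (-(a * ‖z - x‖ ^ 2))) =
      ENNReal.ofReal ((Real.pi / a) ^ (d / 2 : ℝ)) := by
  rw [lintegral_sub_right_eq_self (μ := (volume : Measure (Space d)))
    (fun z => ENNReal.ofReal (Real.exp (-(a * ‖z‖ ^ 2)))) x]
  have h := GaussianFourier.integral_rexp_neg_mul_sq_norm (V := Space d) ha
  simp only [neg_mul, finrank_euclideanSpace, Fintype.card_fin] at h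
  have hpos : 0 < (Real.pi / a) ^ (d / 2 : ℝ) := by positivity
  have hint : Integrable fun z : Space d => Real.exp (-(a * ‖z‖ ^ 2)) := by
    -- The integral is nonzero, whereas that of a non-integrable function is `0` by convention.
    by_contra hn
    rw [integral_undef hn] at h
    linarith
  rw [← ofReal_integral_eq_lintegral_ofReal hint
    (Eventually.of_forall fun z => (Real.exp_pos _).le), h]

lemma lintegral_gauss {s : ℝ} (hs : 0 < s) (x : Space d) :
    ∫⁻ z, gauss (s, z) x = ENNReal.ofReal ((Real.pi / (2 * s)) ^ (d / 2 : ℝ)) := by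
  rw [← lintegral_exp_neg_mul_norm_sub_sq (by positivity) x]
  simp only [gauss, norm_sub_rev x]

lemma lintegral_gauss_mul_gauss {s : ℝ} (hs : 0 < s) (x y : Space d) :
    ∫⁻ z, gauss (s, z) x * gauss (s, z) y =
      ENNReal.ofReal (Real.exp (-(s * ‖x - y‖ ^ 2))) *
        ENNReal.ofReal ((Real.pi / (4 * s)) ^ (d / 2 : ℝ)) := by
  rw [← lintegral_exp_neg_mul_norm_sub_sq (by positivity) ((2 : ℝ)⁻¹ • (x + y)),
    ← lintegral_const_mul _ (by fun_prop)]
  congr 1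
  funext z
  rw [gauss, gauss, ← ENNReal.ofReal_mul (Real.exp_pos _).le,
    ← ENNReal.ofReal_mul (Real.exp_pos _).le, ← Real.exp_add, ← Real.exp_add]
  congr 2
  -- the parallelogram identity for `x - z` and `y - z`
  have h := parallelogram_law_with_norm ℝ (x - z) (y - z)
  have h1 : x - z + (y - z) = (-2 : ℝ) • (z - (2 : ℝ)⁻¹ • (x + y)) := by
    module
  rw [h1, norm_smul, show x - z - (y - z) = x - y by abel, Real.norm_eq_abs,
    abs_of_neg (by norm_num)] at h
  linear_combination s * h

/-- The Riesz kernel is a superposition of products of Gaussians, by the Gamma integral. -/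
lemma kernel_eq_lintegral_gauss (hb0 : b < 0) {x y : Space d} (hxy : x ≠ y) :
    kernel b (x - y) = ∫⁻ p, gauss p x * gauss p y ∂(gaussMeasure d b) := by
  have hm : Measurable fun p : ℝ × Space d => gauss p x * gauss p y :=
    (measurable_gauss.comp (measurable_id.prodMk measurable_const)).mul
      (measurable_gauss.comp (measurable_id.prodMk measurable_const))
  have hxy' : x - y ≠ 0 := sub_ne_zero.2 hxy
  have hn : 0 < ‖x - y‖ := norm_pos_iff.2 hxy'
  have hΓ : 0 < Real.Gamma (-b / 2) := Real.Gamma_pos_of_pos (by linarith)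
  have hcΓ : 0 < (-b) * Real.Gamma (-b / 2) := mul_pos (by linarith) hΓ
  rw [gaussMeasure, lintegral_prod _ hm.aemeasurable, widthMeasure,
    lintegral_withDensity_eq_lintegral_mul _ measurable_widthDensity hm.lintegral_prod_right']
  have h1 : ∀ s ∈ Set.Ioi (0 : ℝ), ((fun s : ℝ => ENNReal.ofReal (s ^ (-b / 2 - 1) /
      ((-b) * Real.Gamma (-b / 2) * (Real.pi / (4 * s)) ^ (d / 2 : ℝ)))) *
      fun s => ∫⁻ z, gauss (s, z) x * gauss (s, z) y) s =
      ENNReal.ofReal ((s ^ (-b / 2 - 1) * Real.exp (-(‖x - y‖ ^ 2 * s))) *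
        ((-b) * Real.Gamma (-b / 2))⁻¹) := by
    intro s hs
    have hs0 : (0 : ℝ) < s := hs
    have hC : 0 < (Real.pi / (4 * s)) ^ (d / 2 : ℝ) := by positivity
    rw [Pi.mul_apply, lintegral_gauss_mul_gauss hs0, ← ENNReal.ofReal_mul (Real.exp_pos _).le,
      ← ENNReal.ofReal_mul (by positivity)]
    congr 1
    rw [mul_comm (‖x - y‖ ^ 2) s]
    field_simp
  have hG := Real.integral_rpow_mul_exp_neg_mul_Ioi (a := -b / 2) (r := ‖x - y‖ ^ 2)
    (by linarith) (by positivity)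
  have hint : IntegrableOn (fun s : ℝ => s ^ (-b / 2 - 1) * Real.exp (-(‖x - y‖ ^ 2 * s)))
      (Set.Ioi 0) := by
    -- The integral is nonzero, whereas that of a non-integrable function is `0` by convention.
    by_contra hn'
    rw [integral_undef hn'] at hG
    have : 0 < (1 / ‖x - y‖ ^ 2) ^ (-b / 2) * Real.Gamma (-b / 2) := by positivity
    linarith
  rw [setLIntegral_congr_fun measurableSet_Ioi h1,
    ← ofReal_integral_eq_lintegral_ofReal (hint.mul_const _)
      ((ae_restrict_iff' measurableSet_Ioi).2 (Eventually.of_forall fun s hs => by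
        have hs0 : (0 : ℝ) < s := hs
        simp only [Pi.zero_apply]
        positivity)),
    integral_mul_const, hG, kernel_of_ne_zero hxy', rieszReal]
  congr 1
  have h2 : (1 / ‖x - y‖ ^ 2) ^ (-b / 2) = ‖x - y‖ ^ b := by
    rw [one_div, Real.inv_rpow (by positivity), ← Real.rpow_neg (by positivity),
      ← Real.rpow_natCast, ← Real.rpow_mul hn.le]
    congr 1
    push_cast
    ring
  rw [h2, mul_inv, mul_comm ((-b)⁻¹), mul_assoc, ← mul_assoc (Real.Gamma _),
    mul_inv_cancel₀ hΓ.ne', one_mul, neg_div, ← div_neg, div_eq_mul_inv]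

/-- The interaction energy `∫∫ W(x - y) dν(y) dμ(x)` of two measures. -/
def interaction (b : ℝ) (μ ν : Measure (Space d)) : ENNReal :=
  ∫⁻ x, ∫⁻ y, kernel b (x - y) ∂ν ∂μ

/-- The integral of the Gaussian `gauss p` against `μ`. -/
def gaussTransform (μ : Measure (Space d)) (p : ℝ × Space d) : ENNReal := ∫⁻ x, gauss p x ∂μ

lemma measurable_gaussTransform (μ : Measure (Space d)) [SFinite μ] :
    Measurable (gaussTransform μ) :=
  measurable_gauss.lintegral_prod_right'

lemma measurable_gauss_right (p : ℝ × Space d) : Measurable (gauss p) :=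
  measurable_gauss.comp (measurable_const.prodMk measurable_id)

lemma lintegral_lintegral_gauss (μ ν : Measure (Space d)) [SFinite μ] [SFinite ν] :
    ∫⁻ x, ∫⁻ y, ∫⁻ p, gauss p x * gauss p y ∂(gaussMeasure d b) ∂ν ∂μ =
      ∫⁻ p, gaussTransform μ p * gaussTransform ν p ∂(gaussMeasure d b) := by
  have h1 : ∀ x : Space d, ∫⁻ y, ∫⁻ p, gauss p x * gauss p y ∂(gaussMeasure d b) ∂ν =
      ∫⁻ p, gauss p x * gaussTransform ν p ∂(gaussMeasure d b) := by
    intro x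
    rw [lintegral_lintegral_swap]
    · refine lintegral_congr fun p => ?_
      rw [gaussTransform, lintegral_const_mul _ (measurable_gauss_right p)]
    · exact ((measurable_gauss.comp (measurable_snd.prodMk measurable_const)).mul
        (measurable_gauss.comp (measurable_snd.prodMk measurable_fst))).aemeasurable
  simp only [h1]
  rw [lintegral_lintegral_swap]
  · refine lintegral_congr fun p => ?_
    rw [lintegral_mul_const _ (measurable_gauss_right p)]
    rfl
  · exact ((measurable_gauss.comp (measurable_snd.prodMk measurable_fst)).mul
      ((measurable_gaussTransform ν).comp measurable_snd)).aemeasurable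

lemma lintegral_gaussTransform_le_interaction (hb0 : b < 0) (μ ν : Measure (Space d))
    [SFinite μ] [SFinite ν] :
    ∫⁻ p, gaussTransform μ p * gaussTransform ν p ∂(gaussMeasure d b) ≤ interaction b μ ν := by
  rw [← lintegral_lintegral_gauss]
  refine lintegral_mono fun x => lintegral_mono fun y => ?_
  by_cases hxy : x = y
  · simp [hxy, kernel_zero]
  · exact (kernel_eq_lintegral_gauss hb0 hxy).ge

lemma interaction_eq_lintegral_gaussTransform (hb0 : b < 0) (μ ν : Measure (Space d))
    [SFinite μ] [SFinite ν] [NullSingletonClass ν] :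
    interaction b μ ν =
      ∫⁻ p, gaussTransform μ p * gaussTransform ν p ∂(gaussMeasure d b) := by
  rw [← lintegral_lintegral_gauss]
  refine lintegral_congr fun x => lintegral_congr_ae ?_
  filter_upwards [compl_mem_ae_iff.2 (measure_singleton (μ := ν) x)] with y hy
  exact kernel_eq_lintegral_gauss hb0 fun h => hy h.symm

lemma gaussTransform_ne_top (μ : Measure (Space d)) [IsFiniteMeasure μ] {p : ℝ × Space d}
    (hp : 0 ≤ p.1) : gaussTransform μ p ≠ ⊤ := by
  have h : gaussTransform μ p ≤ ∫⁻ _, 1 ∂μ := by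
    refine lintegral_mono fun x => ?_
    rw [gauss, ENNReal.ofReal_le_one, Real.exp_le_one_iff]
    have : 0 ≤ p.1 * ‖x - p.2‖ ^ 2 := by positivity
    linarith
  exact ne_top_of_le_ne_top (by simp) h

lemma ae_widthMeasure_pos : ∀ᵐ s ∂(widthMeasure d b), 0 < s :=
  (withDensity_absolutelyContinuous _ _).ae_le (ae_restrict_mem measurableSet_Ioi)

lemma exists_pos_of_ae_widthMeasure (hb0 : b < 0) {P : ℝ → Prop}
    (h : ∀ᵐ s ∂(widthMeasure d b), P s) : ∃ s, 0 < s ∧ P s := by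
  have hΓ : 0 < Real.Gamma (-b / 2) := Real.Gamma_pos_of_pos (by linarith)
  have hcΓ : 0 < (-b) * Real.Gamma (-b / 2) := mul_pos (by linarith) hΓ
  have hac : volume.restrict (Set.Ioi (0 : ℝ)) ≪ widthMeasure d b := by
    refine withDensity_absolutelyContinuous' measurable_widthDensity.aemeasurable ?_
    filter_upwards [ae_restrict_mem measurableSet_Ioi] with s hs
    have hs0 : (0 : ℝ) < s := hs
    rw [ne_eq, ENNReal.ofReal_eq_zero, not_le]
    positivity
  have hne : NeBot (ae (volume.restrict (Set.Ioi (0 : ℝ)))) := by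
    rw [ae_neBot, ne_eq, Measure.restrict_eq_zero]
    simp
  have h' : ∀ᵐ s ∂(volume.restrict (Set.Ioi (0 : ℝ))), P s := hac.ae_le h
  obtain ⟨s, h1, h2⟩ := (h'.and (ae_restrict_mem measurableSet_Ioi)).exists
  exact ⟨s, h2, h1⟩

/-- Gaussian transforms that agree almost everywhere belong to measures of equal mass. -/
lemma measure_univ_eq_of_gaussTransform_ae_eq (hb0 : b < 0) (μ ν : Measure (Space d))
    [SFinite μ] [SFinite ν]
    (h : gaussTransform μ =ᵐ[gaussMeasure d b] gaussTransform ν) :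
    μ Set.univ = ν Set.univ := by
  have hmass : ∀ (η : Measure (Space d)) [SFinite η] {s : ℝ}, 0 < s →
      ∫⁻ z, gaussTransform η (s, z) =
        ENNReal.ofReal ((Real.pi / (2 * s)) ^ (d / 2 : ℝ)) * η Set.univ := by
    intro η _ s hs
    unfold gaussTransform
    rw [lintegral_lintegral_swap]
    · simp only [lintegral_gauss hs, lintegral_const]
    · exact (measurable_gauss.comp ((measurable_const.prodMk measurable_fst).prodMk
        measurable_snd)).aemeasurable
  obtain ⟨s, hs, hae⟩ := exists_pos_of_ae_widthMeasure hb0 (Measure.ae_ae_of_ae_prod h)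
  have h1 := lintegral_congr_ae hae
  rw [hmass μ hs, hmass ν hs] at h1
  have hC : 0 < (Real.pi / (2 * s)) ^ (d / 2 : ℝ) := by positivity
  exact (ENNReal.mul_right_inj (ENNReal.ofReal_pos.2 hC).ne' ENNReal.ofReal_ne_top).1 h1

/-- Strict positive definiteness of the Riesz kernel, in polarized form: if
`⟨μ, μ⟩ + ⟨ν, ν⟩ ≤ 2 ⟨μ, ν⟩ < ∞` then `μ` and `ν` have equal mass. -/
lemma measure_univ_eq_of_interaction_le (hb0 : b < 0) (μ ν : Measure (Space d))
    [IsFiniteMeasure μ] [IsFiniteMeasure ν] [NullSingletonClass ν] (hfin : interaction b μ ν ≠ ⊤)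
    (h : interaction b μ μ + interaction b ν ν ≤ 2 * interaction b μ ν) :
    μ Set.univ = ν Set.univ := by
  refine measure_univ_eq_of_gaussTransform_ae_eq hb0 μ ν ?_
  have hfin_ae : ∀ᵐ p ∂(gaussMeasure d b),
      gaussTransform μ p ≠ ⊤ ∧ gaussTransform ν p ≠ ⊤ := by
    have h1 : ∀ᵐ p ∂(gaussMeasure d b), 0 < p.1 :=
      Measure.quasiMeasurePreserving_fst.ae ae_widthMeasure_pos
    filter_upwards [h1] with p hp
    exact ⟨gaussTransform_ne_top μ hp.le, gaussTransform_ne_top ν hp.le⟩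
  have hmμ := measurable_gaussTransform μ
  have hmν := measurable_gaussTransform ν
  have hle : (fun p => 2 * (gaussTransform μ p * gaussTransform ν p))
      ≤ᵐ[gaussMeasure d b] fun p => gaussTransform μ p * gaussTransform μ p +
        gaussTransform ν p * gaussTransform ν p := by
    filter_upwards [hfin_ae] with p hp
    lift gaussTransform μ p to NNReal using hp.1 with u
    lift gaussTransform ν p to NNReal using hp.2 with v
    norm_cast
    rw [← NNReal.coe_le_coe]
    push_cast
    nlinarith [sq_nonneg ((u : ℝ) - v)]
  have hint : ∫⁻ p, 2 * (gaussTransform μ p * gaussTransform ν p) ∂(gaussMeasure d b) =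
      2 * interaction b μ ν := by
    rw [lintegral_const_mul (f := fun p => gaussTransform μ p * gaussTransform ν p) _
      (hmμ.mul hmν), interaction_eq_lintegral_gaussTransform hb0]
  have hge : ∫⁻ p, (gaussTransform μ p * gaussTransform μ p +
      gaussTransform ν p * gaussTransform ν p) ∂(gaussMeasure d b) ≤
      ∫⁻ p, 2 * (gaussTransform μ p * gaussTransform ν p) ∂(gaussMeasure d b) := by
    rw [hint, lintegral_add_left (f := fun p => gaussTransform μ p * gaussTransform μ p)
      (hmμ.mul hmμ)]
    exact (add_le_add (lintegral_gaussTransform_le_interaction hb0 μ μ)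
      (lintegral_gaussTransform_le_interaction hb0 ν ν)).trans h
  have heq := ae_eq_of_ae_le_of_lintegral_le hle
    (by rw [hint]; exact ENNReal.mul_ne_top (by simp) hfin)
    ((hmμ.mul hmμ).add (hmν.mul hmν)).aemeasurable hge
  filter_upwards [heq, hfin_ae] with p hp hpf
  lift gaussTransform μ p to NNReal using hpf.1 with u
  lift gaussTransform ν p to NNReal using hpf.2 with v
  norm_cast at hp ⊢
  rw [← NNReal.coe_inj] at hp ⊢
  push_cast at hp
  have : ((u : ℝ) - v) ^ 2 = 0 := by linarith
  linarith [pow_eq_zero_iff (two_ne_zero) |>.1 this]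

/-! ### Non-existence of minimizers -/

lemma measurable_lintegral_kernel (ν : Measure (Space d)) [SFinite ν] :
    Measurable fun x => ∫⁻ y, kernel b (x - y) ∂ν :=
  (measurable_kernel.comp (measurable_fst.sub measurable_snd)).lintegral_prod_right'

lemma measurable_kernel_sub (x : Space d) : Measurable fun y => kernel b (x - y) :=
  measurable_kernel.comp (measurable_const.sub measurable_id)

lemma interaction_add_left (μ μ' ν : Measure (Space d)) :
    interaction b (μ + μ') ν = interaction b μ ν + interaction b μ' ν :=
  lintegral_add_measure _ _ _

lemma interaction_smul_left (c : ENNReal) (μ ν : Measure (Space d)) :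
    interaction b (c • μ) ν = c * interaction b μ ν :=
  lintegral_smul_measure _ _

lemma interaction_comm (μ ν : Measure (Space d)) [SFinite μ] [SFinite ν] :
    interaction b μ ν = interaction b ν μ := by
  unfold interaction
  rw [lintegral_lintegral_swap (f := fun x y => kernel b (x - y))
    (measurable_kernel.comp (measurable_fst.sub measurable_snd)).aemeasurable]
  exact lintegral_congr fun y => lintegral_congr fun x => kernel_congr_norm (norm_sub_rev x y)

lemma kernel_smul {t : ℝ} (ht : 0 < t) (x : Space d) :
    kernel b (t • x) = ENNReal.ofReal (t ^ b) * kernel b x := by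
  have htb : 0 < t ^ b := Real.rpow_pos_of_pos ht b
  by_cases hx : x = 0
  · rw [hx, smul_zero, kernel_zero, ENNReal.mul_top (ENNReal.ofReal_pos.2 htb).ne']
  · rw [kernel_of_ne_zero hx, kernel_of_ne_zero (smul_ne_zero ht.ne' hx),
      ← ENNReal.ofReal_mul htb.le, rieszReal, rieszReal, norm_smul, Real.norm_eq_abs,
      abs_of_pos ht, Real.mul_rpow ht.le (norm_nonneg x)]
    congr 1
    ring

lemma interaction_map_smul {t : ℝ} (ht : 0 < t) (μ : Measure (Space d)) [SFinite μ] :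
    interaction b (μ.map fun x => t • x) (μ.map fun x => t • x) =
      ENNReal.ofReal (t ^ b) * interaction b μ μ := by
  have hm : Measurable fun x : Space d => t • x := measurable_const_smul t
  unfold interaction
  rw [lintegral_map (measurable_lintegral_kernel _) hm,
    ← lintegral_const_mul _ (measurable_lintegral_kernel μ)]
  refine lintegral_congr fun x => ?_
  rw [lintegral_map (measurable_kernel_sub _) hm,
    ← lintegral_const_mul _ (measurable_kernel_sub x)]
  refine lintegral_congr fun y => ?_
  rw [← smul_sub, kernel_smul ht]

lemma exists_potential_le (hd : 3 ≤ d) (hb : 2 - (d : ℝ) < b) (hb0 : b < 0)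
    {φ : Space d → ℝ} (h : IsMollifier φ) : ∃ M : ℝ, ∀ x, potential b φ x ≤ M := by
  have hcont := (contDiff_potential hd hb h.smooth h.hasCompactSupport).continuous
  have hlim := tendsto_potential hd hb hb0 h.smooth.continuous h.nonneg h.supported
    h.integral_eq_one
  obtain ⟨K, hK, hKs⟩ := mem_cocompact.1 (hlim.eventually_lt_const one_pos)
  obtain ⟨M, hM⟩ := hK.bddAbove_image hcont.continuousOn
  refine ⟨max M 1, fun x => ?_⟩
  by_cases hx : x ∈ K
  · exact (hM ⟨x, hx, rfl⟩).trans (le_max_left _ _)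
  · exact (le_of_lt (hKs hx)).trans (le_max_right _ _)

lemma interaction_densityMeasure (hd : 3 ≤ d) (hb : 2 - (d : ℝ) < b) (hb0 : b < 0)
    {φ : Space d → ℝ} (h : IsMollifier φ) (μ : Measure (Space d)) :
    interaction b μ (densityMeasure φ) = ∫⁻ x, ENNReal.ofReal (potential b φ x) ∂μ :=
  lintegral_congr fun x => lintegral_kernel_densityMeasure hd hb hb0 h.smooth.continuous
    h.hasCompactSupport h.nonneg x

lemma interaction_densityMeasure_ne_top (hd : 3 ≤ d) (hb : 2 - (d : ℝ) < b) (hb0 : b < 0)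
    {φ : Space d → ℝ} (h : IsMollifier φ) (μ : Measure (Space d)) [IsFiniteMeasure μ] :
    interaction b μ (densityMeasure φ) ≠ ⊤ := by
  obtain ⟨M, hM⟩ := exists_potential_le hd hb hb0 h
  rw [interaction_densityMeasure hd hb hb0 h]
  refine ne_top_of_le_ne_top ?_ (lintegral_mono fun x => ENNReal.ofReal_le_ofReal (hM x))
  rw [lintegral_const]
  exact ENNReal.mul_ne_top ENNReal.ofReal_ne_top (measure_ne_top _ _)

lemma energy_eq_interaction (hd : 3 ≤ d) (hb : 2 - (d : ℝ) < b) (hb0 : b < 0)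
    {φ : Space d → ℝ} (h : IsMollifier φ) {α : ℝ} (hα : 0 ≤ α) (μ : Measure (Space d)) :
    energy (riesz b) (fun x => ((α * -potential b φ x : ℝ) : EReal)) μ =
      ((1 / 2 : ℝ) : EReal) * (interaction b μ μ : EReal) -
        ((ENNReal.ofReal α * interaction b μ (densityMeasure φ) : ENNReal) : EReal) := by
  have hpos : ∀ x, 0 ≤ potential b φ x := potential_nonneg hb0 h.nonneg
  have h1 : extIntegral μ (fun x => extIntegral μ (fun y => riesz b (x - y))) =
      (interaction b μ μ : EReal) := by
    rw [extIntegral_of_nonneg]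
    · unfold interaction
      congr 1
      refine lintegral_congr fun x => ?_
      rw [extIntegral_of_nonneg μ fun y => riesz_nonneg hb0 _, EReal.toENNReal_coe]
      rfl
    · intro x
      rw [extIntegral_of_nonneg μ fun y => riesz_nonneg hb0 _]
      exact EReal.coe_ennreal_nonneg _
  have h2 : ∀ x, ((α * -potential b φ x : ℝ) : EReal).toENNReal = 0 := by
    intro x
    refine EReal.toENNReal_of_nonpos ?_
    exact_mod_cast mul_nonpos_of_nonneg_of_nonpos hα (neg_nonpos.2 (hpos x))
  have h3 : ∀ x, (-((α * -potential b φ x : ℝ) : EReal)).toENNReal =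
      ENNReal.ofReal α * ENNReal.ofReal (potential b φ x) := by
    intro x
    rw [← EReal.coe_neg, EReal.toENNReal_of_ne_top (EReal.coe_ne_top _), EReal.toReal_coe,
      ← ENNReal.ofReal_mul hα]
    congr 1
    ring
  have hm : Measurable fun x => ENNReal.ofReal (potential b φ x) :=
    (contDiff_potential hd hb h.smooth h.hasCompactSupport).continuous.measurable.ennreal_ofReal
  rw [energy, h1, extIntegral]
  simp only [h2, h3]
  rw [lintegral_zero, lintegral_const_mul _ hm, interaction_densityMeasure hd hb hb0 h,
    EReal.coe_ennreal_zero, zero_sub, sub_eq_add_neg]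

lemma energy_eq_coe (hd : 3 ≤ d) (hb : 2 - (d : ℝ) < b) (hb0 : b < 0)
    {φ : Space d → ℝ} (h : IsMollifier φ) (a : NNReal) (μ : Measure (Space d)) {u v : NNReal}
    (hu : interaction b μ μ = u) (hv : interaction b μ (densityMeasure φ) = v) :
    energy (riesz b) (fun x => (((a : ℝ) * -potential b φ x : ℝ) : EReal)) μ =
      ((1 / 2 * u - a * v : ℝ) : EReal) := by
  rw [energy_eq_interaction hd hb hb0 h a.coe_nonneg, hu, hv, ENNReal.ofReal_coe_nnreal,
    ← ENNReal.coe_mul]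
  rfl

/-- Spreading the mass `1 - α` out to infinity gives competitors `α φ + (1 - α) φ_n` whose
energies tend to the unconstrained minimum `-α² ⟨φ, φ⟩ / 2`, which no probability measure
attains. -/
lemma not_exists_isMinimizer (hd : 3 ≤ d) (hb : 2 - (d : ℝ) < b) (hb0 : b < 0)
    {φ : Space d → ℝ} (h : IsMollifier φ) {α : ℝ} (hα0 : 0 < α) (hα1 : α < 1) :
    ¬ ∃ μ : Measure (Space d),
      IsMinimizer (riesz b) (fun x => ((α * -potential b φ x : ℝ) : EReal)) μ := by
  rintro ⟨ρ, hρ, hmin⟩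
  lift α to NNReal using hα0.le
  obtain ⟨β, hβ⟩ : ∃ β : NNReal, α + β = 1 := 
    ⟨1 - α, add_tsub_cancel_of_le (by exact_mod_cast hα1.le)⟩
  have hΦ : IsProbabilityMeasure (densityMeasure φ) :=
    isProbabilityMeasure_densityMeasure h.smooth.continuous h.hasCompactSupport h.nonneg
      h.integral_eq_one
  have hatoms : NullSingletonClass (densityMeasure φ) := by
    have : Nonempty (Fin d) := ⟨⟨0, by omega⟩⟩
    refine ⟨fun x => withDensity_absolutelyContinuous _ _ (measure_singleton x)⟩
  set Φ := densityMeasure φ with hΦdef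
  have hfin : ∀ (μ : Measure (Space d)) [IsFiniteMeasure μ], interaction b μ Φ ≠ ⊤ :=
    fun μ _ => interaction_densityMeasure_ne_top hd hb hb0 h μ
  obtain ⟨A, hA⟩ : ∃ A : NNReal, interaction b Φ Φ = A :=
    ⟨_, (ENNReal.coe_toNNReal (hfin Φ)).symm⟩
  obtain ⟨v, hv⟩ : ∃ v : NNReal, interaction b ρ Φ = v :=
    ⟨_, (ENNReal.coe_toNNReal (hfin ρ)).symm⟩
  have hcomp : ∀ n : ℕ, energy (riesz b) (fun x => (((α : ℝ) * -potential b φ x : ℝ) : EReal)) ρ ≤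
      (((β : ℝ) ^ 2 / 2 * ((n : ℝ) + 1) ^ b * A - (α : ℝ) ^ 2 / 2 * A : ℝ) : EReal) := by
    intro n
    have ht : (0 : ℝ) < (n : ℝ) + 1 := by positivity
    have hm : Measurable fun x : Space d => ((n : ℝ) + 1) • x := measurable_const_smul _
    -- `σ` is the mass pushed out to infinity; its self-energy is `(n + 1)^b ⟨φ, φ⟩`.
    set σ : Measure (Space d) := Φ.map fun x => ((n : ℝ) + 1) • x with hσ
    have hσp : IsProbabilityMeasure σ := Measure.isProbabilityMeasure_map hm.aemeasurable
    obtain ⟨B, hB⟩ : ∃ B : NNReal, interaction b σ Φ = B :=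
      ⟨_, (ENNReal.coe_toNNReal (hfin σ)).symm⟩
    set t : NNReal := (((n : ℝ) + 1) ^ b).toNNReal with htdef
    have htr : (t : ℝ) = ((n : ℝ) + 1) ^ b := Real.coe_toNNReal _ (by positivity)
    have hσσ : interaction b σ σ = (t * A : NNReal) := by
      rw [hσ, interaction_map_smul ht, hA]
      rfl
    set ν : Measure (Space d) := (α : ENNReal) • Φ + (β : ENNReal) • σ with hν
    have hνp : IsProbabilityMeasure ν := by
      constructor
      rw [hν, Measure.add_apply, Measure.smul_apply, Measure.smul_apply, measure_univ,
        measure_univ, smul_eq_mul, smul_eq_mul, mul_one, mul_one]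
      exact_mod_cast hβ
    have hνΦ : interaction b ν Φ = (α * A + β * B : NNReal) := by
      rw [hν, interaction_add_left, interaction_smul_left, interaction_smul_left, hA, hB]
      push_cast
      rfl
    have hνσ : interaction b ν σ = (α * B + β * (t * A) : NNReal) := by
      rw [hν, interaction_add_left, interaction_smul_left, interaction_smul_left, hσσ,
        interaction_comm Φ σ, hB]
      push_cast
      rfl
    have hνν : interaction b ν ν =
        (α * (α * A + β * B) + β * (α * B + β * (t * A)) : NNReal) := by
      nth_rw 1 [hν]
      rw [interaction_add_left, interaction_smul_left, interaction_smul_left,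
        interaction_comm Φ ν, interaction_comm σ ν, hνΦ, hνσ]
      push_cast
      rfl
    -- The cross terms `α β ⟨σ, φ⟩` of the two parts of the energy cancel.
    refine (hmin ν hνp).trans_eq ?_
    rw [energy_eq_coe hd hb hb0 h α ν hνν hνΦ, ← htr]
    congr 1
    push_cast
    ring
  have hρtop : interaction b ρ ρ ≠ ⊤ := by
    intro htop
    have h0 := hcomp 0
    rw [energy_eq_interaction hd hb hb0 h α.coe_nonneg, htop, ← hΦdef, hv,
      ENNReal.ofReal_coe_nnreal, ← ENNReal.coe_mul, EReal.coe_ennreal_top,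
      EReal.coe_mul_top_of_pos (by norm_num)] at h0
    exact absurd (top_le_iff.1 h0) (EReal.coe_ne_top _)
  obtain ⟨u, hu⟩ : ∃ u : NNReal, interaction b ρ ρ = u :=
    ⟨_, (ENNReal.coe_toNNReal hρtop).symm⟩
  have hle : (1 / 2 * u - α * v : ℝ) ≤ -((α : ℝ) ^ 2 / 2 * A) := by
    have hlim : Tendsto (fun n : ℕ => (β : ℝ) ^ 2 / 2 * ((n : ℝ) + 1) ^ b * A -
        (α : ℝ) ^ 2 / 2 * A) atTop (𝓝 ((β : ℝ) ^ 2 / 2 * 0 * A - (α : ℝ) ^ 2 / 2 * A)) := by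
      have h1 : Tendsto (fun n : ℕ => ((n : ℝ) + 1) ^ b) atTop (𝓝 0) := by
        have h2 := (tendsto_rpow_neg_atTop (y := -b) (by linarith)).comp
          (tendsto_atTop_add_const_right _ (1 : ℝ) tendsto_natCast_atTop_atTop)
        simpa [Function.comp_def] using h2
      exact ((h1.const_mul _).mul_const _).sub_const _
    have h3 := ge_of_tendsto' hlim fun n => by
      have h4 := hcomp n
      rw [energy_eq_coe hd hb hb0 h α ρ hu hv, EReal.coe_le_coe_iff] at h4
      exact h4
    linarith
  have hΦα : interaction b ρ ((α : ENNReal) • Φ) = (α * v : NNReal) := by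
    rw [interaction_comm, interaction_smul_left, interaction_comm, hv, ENNReal.coe_mul]
  have hαα : interaction b ((α : ENNReal) • Φ) ((α : ENNReal) • Φ) = (α * (α * A) : NNReal) := by
    rw [interaction_smul_left, interaction_comm, interaction_smul_left, hA]
    push_cast
    rfl
  have hatoms' : NullSingletonClass ((α : ENNReal) • Φ) :=
    ⟨fun x => by rw [Measure.smul_apply, measure_singleton, smul_zero]⟩
  have hfinα : IsFiniteMeasure ((α : ENNReal) • Φ) := Measure.smul_finite _ ENNReal.coe_ne_top
  have hmass := measure_univ_eq_of_interaction_le hb0 ρ ((α : ENNReal) • Φ)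
    (by rw [hΦα]; exact ENNReal.coe_ne_top) (by
      rw [hu, hΦα, hαα]
      norm_cast
      rw [← NNReal.coe_le_coe]
      push_cast
      linarith)
  rw [Measure.smul_apply, measure_univ, measure_univ, smul_eq_mul, mul_one] at hmass
  norm_cast at hmass
  rw [← hmass] at hα1
  simp at hα1

/-! ### Superharmonicity of the Riesz kernel -/

lemma rieszReg_zero_right (x : Space d) : rieszReg b 0 x = rieszReal b x := by
  rw [rieszReg, rieszReal, neg_div, ← div_neg, add_zero, ← Real.rpow_natCast,
    ← Real.rpow_mul (norm_nonneg x)]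
  congr 2
  push_cast
  ring

lemma laplacian_rieszReal (hb0 : b < 0) {x : Space d} (hx : x ≠ 0) :
    Laplacian.laplacian (rieszReal b : Space d → ℝ) x = -radialDiv 0 (b / 2 - 1) x := by
  have hpos : ∀ {y : Space d}, y ≠ 0 → 0 < ‖y‖ ^ 2 + 0 := fun {y} hy => by
    have := norm_pos_iff.2 hy
    positivity
  set L : Space d →L[ℝ] Space d →L[ℝ] ℝ := innerSL ℝ with hL
  have hLi : ∀ u v : Space d, L u v = inner ℝ u v := fun _ _ => rfl
  have hf : fderiv ℝ (rieszReal b : Space d → ℝ) =ᶠ[𝓝 x]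
      fun y => (-(‖y‖ ^ 2 + 0) ^ (b / 2 - 1)) • L y := by
    filter_upwards [isOpen_compl_singleton.mem_nhds hx] with y hy
    rw [show (rieszReal b : Space d → ℝ) = rieszReg b 0 from
      funext fun z => (rieszReg_zero_right z).symm]
    exact (hasFDerivAt_rieszReg hb0 (hpos hy)).fderiv
  have hd2 : HasFDerivAt (fun y => (-(‖y‖ ^ 2 + 0) ^ (b / 2 - 1)) • L y)
      ((-(‖x‖ ^ 2 + 0) ^ (b / 2 - 1)) • L +
        (-((2 * (b / 2 - 1) * (‖x‖ ^ 2 + 0) ^ (b / 2 - 1 - 1)) • L x)).smulRight (L x)) x :=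
    (hasFDerivAt_normSq_add_rpow (b / 2 - 1) (hpos hx)).neg.smul L.hasFDerivAt
  rw [InnerProductSpace.laplacian_eq_iteratedFDeriv_orthonormalBasis _
    (EuclideanSpace.basisFun (Fin d) ℝ), ← sum_fderiv_radialField _ (hpos hx),
    ← Finset.sum_neg_distrib]
  refine Finset.sum_congr rfl fun i _ => ?_
  rw [iteratedFDeriv_two_apply, hf.fderiv_eq, (hasFDerivAt_radialField _ i (hpos hx)).fderiv,
    hd2.fderiv]
  simp [hLi, EuclideanSpace.inner_single_right]
  ring

lemma laplacian_riesz_neg (hb : 2 - (d : ℝ) < b) (hb0 : b < 0) {x : Space d}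
    (hx : x ≠ 0) :
    Laplacian.laplacian (fun y : Space d => (riesz b y).toReal) x < 0 := by
  have hpos : 0 < ‖x‖ ^ 2 + 0 := by
    have := norm_pos_iff.2 hx
    positivity
  rw [show (fun y : Space d => (riesz b y).toReal) = rieszReal b from funext (toReal_riesz hb0),
    laplacian_rieszReal hb0 hx, neg_lt_zero]
  exact (mul_pos (by linarith) (Real.rpow_pos_of_pos hpos _)).trans_le
    (le_radialDiv hb0 le_rfl hpos)

/-! ### Existence of mollifiers and conclusion -/

lemma exists_isMollifier (d : ℕ) : ∃ φ : Space d → ℝ, IsMollifier φ := by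
  set f : Space d → ℝ := fun x => Real.smoothTransition (1 - ‖x‖ ^ 2) with hf
  have hfs : ContDiff ℝ ∞ f :=
    Real.smoothTransition.contDiff.comp (contDiff_const.sub (contDiff_norm_sq ℝ))
  have hf0 : ∀ x, 0 ≤ f x := fun x => Real.smoothTransition.nonneg _
  have hsupp : tsupport f ⊆ closedBall 0 1 := by
    refine closure_minimal (fun x hx => ?_) isClosed_closedBall
    rw [mem_closedBall_zero_iff]
    by_contra! h
    exact hx (Real.smoothTransition.zero_of_nonpos (by nlinarith))
  have hc : HasCompactSupport f := (isCompact_closedBall 0 1).of_isClosed_subset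
    (isClosed_tsupport f) hsupp
  have hdec : ∀ x y, ‖x‖ ≤ ‖y‖ → f y ≤ f x := fun x y hxy =>
    Real.smoothTransition.monotone
      (sub_le_sub_left (pow_le_pow_left₀ (norm_nonneg x) hxy 2) 1)
  have hpos : 0 < ∫ x, f x :=
    hfs.continuous.integral_pos_of_hasCompactSupport_nonneg_nonzero hc hf0 (x := 0)
      (by simp [hf, Real.smoothTransition.one])
  refine ⟨fun x => (∫ x, f x)⁻¹ * f x, contDiff_const.mul hfs,
    fun x => mul_nonneg (inv_nonneg.2 hpos.le) (hf0 x),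
    fun x y hxy => mul_le_mul_of_nonneg_left (hdec x y hxy) (inv_nonneg.2 hpos.le),
    (tsupport_mul_subset_right).trans hsupp, ?_⟩
  rw [integral_const_mul, inv_mul_cancel₀ hpos.ne']

lemma exists_subthreshold_without_minimizer (hd : 3 ≤ d) (hb : 2 - (d : ℝ) < b) (hb0 : b < 0)
    {φ : Space d → ℝ} (h : IsMollifier φ) :
    ∃ U : Space d → ℝ,
      (∀ x, (U x : EReal) = -conv (riesz b) (densityMeasure φ) x) ∧
      ContDiff ℝ ∞ U ∧ IsRadial U ∧ Tendsto U (cocompact (Space d)) (𝓝 0) ∧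
      ∃ α₀ : ℝ, 0 < α₀ ∧ α₀ < 1 ∧ ∀ α : ℝ, α₀ < α → α < 1 →
        (∃ (ρ : Space d → ℝ) (R : ℝ),
          IsSubthreshold (riesz b) (fun x => ((α * U x : ℝ) : EReal)) ρ R) ∧
        ¬ ∃ μ : Measure (Space d),
          IsMinimizer (riesz b) (fun x => ((α * U x : ℝ) : EReal)) μ := by
  obtain ⟨α₀, h0, h1, hsub⟩ := exists_isSubthreshold hd hb hb0 h
  refine ⟨fun x => -potential b φ x, fun x => ?_,
    (contDiff_potential hd hb h.smooth h.hasCompactSupport).neg,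
    fun x y hxy => congrArg Neg.neg (isRadial_potential h.isRadial x y hxy), ?_,
    α₀, h0, h1, fun α hα hα1 =>
      ⟨hsub α hα, not_exists_isMinimizer hd hb hb0 h (h0.trans hα) hα1⟩⟩
  · rw [conv_densityMeasure hd hb hb0 h.smooth.continuous h.hasCompactSupport h.nonneg,
      EReal.coe_neg]
  · simpa using (tendsto_potential hd hb hb0 h.smooth.continuous h.nonneg h.supported
      h.integral_eq_one).neg

end InteractionEnergy

end

theorem mainTheorem3 (d : ℕ) (hd : 3 ≤ d) (b : ℝ) (hb : 2 - (d : ℝ) < b) (hb0 : b < 0) :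
    -- `W` is strictly superharmonic away from the origin
    (∀ x : EuclideanSpace ℝ (Fin d), x ≠ 0 →
      Laplacian.laplacian
        (fun y : EuclideanSpace ℝ (Fin d) => (InteractionEnergy.riesz b y).toReal) x < 0) ∧
    -- existence of the external potential `U` and of `ρ♯`
    (∃ U : EuclideanSpace ℝ (Fin d) → ℝ,
      ContDiff ℝ ∞ U ∧ InteractionEnergy.IsRadial U ∧
      Tendsto U (cocompact (EuclideanSpace ℝ (Fin d))) (𝓝 0) ∧
      (∃ (ρ : EuclideanSpace ℝ (Fin d) → ℝ) (R : ℝ),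
        InteractionEnergy.IsSubthreshold (InteractionEnergy.riesz b)
          (fun x => (U x : EReal)) ρ R) ∧
      ¬ ∃ μ : Measure (EuclideanSpace ℝ (Fin d)),
        InteractionEnergy.IsMinimizer (InteractionEnergy.riesz b)
          (fun x => (U x : EReal)) μ) ∧
    -- the construction: `α U` with `U = - W * φ`, for every mollifier `φ` and `α < 1` close to `1`
    (∀ φ : EuclideanSpace ℝ (Fin d) → ℝ, InteractionEnergy.IsMollifier φ →
      ∃ U : EuclideanSpace ℝ (Fin d) → ℝ,
        (∀ x, (U x : EReal) =
          -InteractionEnergy.conv (InteractionEnergy.riesz b)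
            (InteractionEnergy.densityMeasure φ) x) ∧
        ContDiff ℝ ∞ U ∧ InteractionEnergy.IsRadial U ∧
        Tendsto U (cocompact (EuclideanSpace ℝ (Fin d))) (𝓝 0) ∧
        ∃ α₀ : ℝ, 0 < α₀ ∧ α₀ < 1 ∧ ∀ α : ℝ, α₀ < α → α < 1 →
          (∃ (ρ : EuclideanSpace ℝ (Fin d) → ℝ) (R : ℝ),
            InteractionEnergy.IsSubthreshold (InteractionEnergy.riesz b)
              (fun x => ((α * U x : ℝ) : EReal)) ρ R) ∧
          ¬ ∃ μ : Measure (EuclideanSpace ℝ (Fin d)),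
            InteractionEnergy.IsMinimizer (InteractionEnergy.riesz b)
              (fun x => ((α * U x : ℝ) : EReal)) μ) := by
  have hmoll := fun φ hφ =>
    InteractionEnergy.exists_subthreshold_without_minimizer (φ := φ) hd hb hb0 hφ
  refine ⟨fun x hx => InteractionEnergy.laplacian_riesz_neg hb hb0 hx, ?_, hmoll⟩
  obtain ⟨φ, hφ⟩ := InteractionEnergy.exists_isMollifier d
  obtain ⟨U, -, hU, hUr, hU0, α₀, h0, h1, hα⟩ := hmoll φ hφ
  obtain ⟨α, hα0, hα1⟩ := exists_between h1
  refine ⟨fun x => α * U x, contDiff_const.mul hU,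
    fun x y hxy => congrArg (α * ·) (hUr x y hxy), ?_, hα α hα0 hα1⟩
  simpa using hU0.const_mul α
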